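/- Let $n,d\ge 1$ and $f(x)=\frac1n\sum_{i=1}^n f_i(x)$ on $\mathbb R^d$, where each $f_i:\mathbb R^d\to\mathbb R$ is differentiable, is bounded below by $\bar f_i\in\mathbb R$, and has an $L$-Lipschitz gradient for a common $L>0$. Let $\bar f\in\mathbb R$ be a lower bound of $f$. Random reshuffling (RR) with step size $\alpha$ starts at $x_0\in\mathbb R^d$; in iteration $t=0,1,\dots$ it draws a permutation $\pi_t$ of $\{1,\dots,n\}$ uniformly at random, independently of the previous ones, sets $x_t^0=x_t$, $x_t^i=x_t^{i-1}-\alpha\nabla f_{\pi_t^i}(x_t^{i-1})$ for $i=1,\dots,n$, and $x_{t+1}=x_t^n$. Thus $T$ iterations use $nT$ evaluations of component gradients. For $T\ge 1$ and $\delta\in(0,1)$ put $$A=2L,\quad B=\frac An\sum_{i=1}^n(\bar f-\bar f_i),\quad F=3(f(x_0)-\bar f)+\frac{3B}{A},\quad C_1=32L^2A\log^2\frac{8nT}{\delta},$$ and let RR use the constant step size $\alpha=\min\bigl\{\frac1{4nL},\,(C_1n^2T)^{-1/3}\bigr\}$. (i) With probability at least $1-\delta$, $$\frac1T\sum_{t=0}^{T-1}\|\nabla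 f(x_t)\|^2\le\max\left\{\frac{45LF}{T},\ \frac{35\,L^{2/3}A^{1/3}F\log^{2/3}(8nT/\delta)}{n^{1/3}T^{2/3}}\right\}.$$ (ii) Consequently, RR needs at most $nT=\tilde{\mathcal O}(\max\{\sqrt n\,\varepsilon^{-3},n\varepsilon^{-2}\})$ gradient evaluations to make this average at most $\varepsilon^2$. Precisely: for all $L>0$ and $\Phi\in\mathbb R$ there is a constant $K>0$, depending only on $L$ and $\Phi$, such that for all $n\ge1$, $\varepsilon\in(0,1]$ and $\delta\in(0,1)$ there is an integer $T_0\ge1$ with $$nT_0\le K\max\{\sqrt n\,\varepsilon^{-3},\,n\varepsilon^{-2}\}\bigl(1+\log(\sqrt n\,\varepsilon^{-3}/\delta)\bigr)$$ such that for every $T\ge T_0$, and for every problem as above with $F\le\Phi$, RR with the above step size satisfies $\frac1T\sum_{t=0}^{T-1}\|\nabla f(x_t)\|^2\le\varepsilon^2$ with probability at least $1-\delta$. -/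

import Mathlib

open MeasureTheory ProbabilityTheory
open scoped NNReal

noncomputable section

namespace RandomReshuffling

/-- The finite-sum objective `f(x) = (1/n) ∑ i, f_i(x)` on `ℝ^d`. -/
def objective {d n : ℕ} (f : Fin n → EuclideanSpace ℝ (Fin d) → ℝ)
    (x : EuclideanSpace ℝ (Fin d)) : ℝ :=
  (1 / (n : ℝ)) * ∑ i, f i x

/-- Every component `f_i` is differentiable, is bounded from below by `lb i`, and has an
`L`-Lipschitz gradient. -/
structure SmoothBoundedBelow {d n : ℕ} (f : Fin n → EuclideanSpace ℝ (Fin d) → ℝ)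
    (lb : Fin n → ℝ) (L : ℝ≥0) : Prop where
  differentiable : ∀ i, Differentiable ℝ (f i)
  lower_bound : ∀ i x, lb i ≤ f i x
  lipschitz : ∀ i, LipschitzWith L (gradient (f i))

/-- `π 0, π 1, …` are independent random permutations of the `n` indices, each of them uniformly
distributed on all permutations. -/
structure IsUniformReshuffling {Ω : Type*} [MeasurableSpace Ω] (μ : Measure Ω) {n : ℕ}
    (π : ℕ → Ω → Equiv.Perm (Fin n)) : Prop where
  measurable : ∀ t σ, MeasurableSet {ω | π t ω = σ}
  uniform : ∀ t σ, μ.real {ω | π t ω = σ} = 1 / (Nat.factorial n : ℝ)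
  indep : iIndepFun (m := fun _ => (⊤ : MeasurableSpace (Equiv.Perm (Fin n)))) π μ

/-- The inner iterates of one pass: `innerIterate f α σ x i` is the point reached from `x` after
the first `i` gradient steps, taken along the components `σ 0, σ 1, …` in this order. Only
`i ≤ n` is meaningful; the value stays constant afterwards. -/
def innerIterate {d n : ℕ} (f : Fin n → EuclideanSpace ℝ (Fin d) → ℝ) (α : ℝ)
    (σ : Equiv.Perm (Fin n)) (x : EuclideanSpace ℝ (Fin d)) : ℕ → EuclideanSpace ℝ (Fin d)
  | 0 => x
  | i + 1 =>
    if h : i < n then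
      innerIterate f α σ x i - α • gradient (f (σ ⟨i, h⟩)) (innerIterate f α σ x i)
    else innerIterate f α σ x i

/-- The outer iterates `x_t` of random reshuffling, started at `x₀`, with step sizes `α t` and
with the permutation `σ t` used in pass `t`. Each pass evaluates `n` component gradients. -/
def iterate {d n : ℕ} (f : Fin n → EuclideanSpace ℝ (Fin d) → ℝ) (α : ℕ → ℝ)
    (σ : ℕ → Equiv.Perm (Fin n)) (x₀ : EuclideanSpace ℝ (Fin d)) :
    ℕ → EuclideanSpace ℝ (Fin d)
  | 0 => x₀
  | t + 1 => innerIterate f (α t) (σ t) (iterate f α σ x₀ t) n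

/-- The constant `A = 2L`. -/
def constA (L : ℝ) : ℝ := 2 * L

/-- The constant `B = (A/n) ∑ i, (f̄ - f̄_i)`, with `fbar = f̄` and `lb i = f̄_i`. -/
def constB (L : ℝ) {n : ℕ} (lb : Fin n → ℝ) (fbar : ℝ) : ℝ :=
  constA L / n * ∑ i, (fbar - lb i)

/-- The constant `F = 3 (f(x₀) - f̄) + 3 B / A`. -/
def constF (L : ℝ) {d n : ℕ} (f : Fin n → EuclideanSpace ℝ (Fin d) → ℝ) (lb : Fin n → ℝ)
    (fbar : ℝ) (x₀ : EuclideanSpace ℝ (Fin d)) : ℝ :=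
  3 * (objective f x₀ - fbar) + 3 * constB L lb fbar / constA L

/-- The constant `C₁ = 32 L² A log²(8nT/δ)`. -/
def constC₁ (L : ℝ) (n T : ℕ) (δ : ℝ) : ℝ :=
  32 * L ^ 2 * constA L * Real.log (8 * n * T / δ) ^ 2

/-- The constant step size `α = min {1/(4nL), 1/(C₁ n² T)^{1/3}}`. -/
def stepSize (L : ℝ) (n T : ℕ) (δ : ℝ) : ℝ :=
  min (1 / (4 * n * L)) (1 / (constC₁ L n T δ * (n : ℝ) ^ 2 * T) ^ (1 / 3 : ℝ))

/-- `(1/T) ∑_{t < T} ‖∇f(x_t)‖²` along the run of random reshuffling with the above constant step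
size for the horizon `T` and the confidence parameter `δ`. -/
def avgSqGrad (L : ℝ) {d n : ℕ} (f : Fin n → EuclideanSpace ℝ (Fin d) → ℝ)
    (x₀ : EuclideanSpace ℝ (Fin d)) (T : ℕ) (δ : ℝ) (σ : ℕ → Equiv.Perm (Fin n)) : ℝ :=
  (1 / (T : ℝ)) * ∑ t ∈ Finset.range T,
    ‖gradient (objective f) (iterate f (fun _ => stepSize L n T δ) σ x₀ t)‖ ^ 2

end RandomReshuffling

end

/-!
The gap `g = f - (1/n) ∑ i, f̄_i` is nonnegative and bounds all component gradients at once: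
`∑ i, ‖∇f_i‖² ≤ 2 n L g`. One pass with step size `α` is a gradient step on `f` with step size `n α`
up to an error, caused by the drift of the inner iterates. This drift is governed by the partial
sums of the deviations `∇f_i - ∇f` at the start of the pass, taken in the order of the permutation.
Sampling without replacement concentrates these sums in a Hilbert space exactly as independent
sampling would, without any dimension factor: their exponential moments are bounded by induction on
`n`, removing the first index and spreading its value evenly over the remaining ones. So they are of
size `√(n L g)` up to a logarithm. The permutation of a pass is independent of its start point, so a
union bound makes this hold throughout all `T` passes with probability `1 - δ`. Then
`g (x_{t+1}) + (n α / 3) ‖∇f (x_t)‖² ≤ (1 + q) g (x_t)` with `q T ≤ 1` by the choice of `α`, and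
hence `∑ t, (n α / 3) ‖∇f (x_t)‖² ≤ e g (x_0)`.
-/

noncomputable section

namespace RandomReshuffling

open Finset
open scoped BigOperators

section Concentration

variable {E : Type*} [NormedAddCommGroup E]

/-- `exp √(1 + ‖x‖²)`, a smooth majorant of `exp ‖x‖`: the exponential moments of partial sums are
taken with respect to it. -/
def expNorm (x : E) : ℝ := Real.exp √(1 + ‖x‖ ^ 2)

lemma expNorm_pos (x : E) : 0 < expNorm x := Real.exp_pos _

@[simp] lemma expNorm_zero : expNorm (0 : E) = Real.exp 1 := by simp [expNorm]

lemma exp_norm_le_expNorm (x : E) : Real.exp ‖x‖ ≤ expNorm x :=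
  Real.exp_le_exp.2 <| Real.le_sqrt_of_sq_le <| by linarith

lemma norm_le_half_of_sum_sq_norm_le {ι : Type*} [Fintype ι] {v : ι → E}
    (hQ : ∑ i, ‖v i‖ ^ 2 ≤ 1 / 4) (i : ι) : ‖v i‖ ≤ 1 / 2 := by
  have : ‖v i‖ ^ 2 ≤ 1 / 4 :=
    (single_le_sum (f := fun i => ‖v i‖ ^ 2) (fun _ _ => by positivity) (mem_univ i)).trans hQ
  nlinarith [norm_nonneg (v i)]

variable [InnerProductSpace ℝ E]

lemma sqrt_one_add_sq_norm_add_le (u w : E) :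
    √(1 + ‖u + w‖ ^ 2) ≤
      √(1 + ‖u‖ ^ 2) + (inner ℝ ((√(1 + ‖u‖ ^ 2))⁻¹ • u) w + ‖w‖ ^ 2 / 2) := by
  set r := √(1 + ‖u‖ ^ 2)
  have hr_sq : r ^ 2 = 1 + ‖u‖ ^ 2 := Real.sq_sqrt (by positivity)
  have hr : 1 ≤ r := Real.one_le_sqrt.2 (by linarith [sq_nonneg ‖u‖])
  set a := inner ℝ (r⁻¹ • u) w
  have ha : inner ℝ u w = r * a := by
    simp only [a, real_inner_smul_left]; field_simp
  have hexpand : 1 + ‖u + w‖ ^ 2 = r ^ 2 + 2 * (r * a) + ‖w‖ ^ 2 := by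
    rw [norm_add_sq_real, ha, hr_sq]; ring
  refine Real.sqrt_le_iff.2 ⟨?_, ?_⟩
  · -- twice the right-hand side is at least `(1 + ‖u + w‖²) / r`
    have : 0 ≤ r * (r + (a + ‖w‖ ^ 2 / 2)) := by nlinarith [sq_nonneg ‖w‖, sq_nonneg ‖u + w‖]
    exact nonneg_of_mul_nonneg_right this (by linarith)
  · nlinarith [sq_nonneg (a + ‖w‖ ^ 2 / 2), mul_nonneg (sub_nonneg.2 hr) (sq_nonneg ‖w‖)]

lemma norm_inv_sqrt_smul_le_one (u : E) : ‖(√(1 + ‖u‖ ^ 2))⁻¹ • u‖ ≤ 1 := by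
  have hr : ‖u‖ ≤ √(1 + ‖u‖ ^ 2) := Real.le_sqrt_of_sq_le (by linarith)
  rw [norm_smul, norm_inv, Real.norm_of_nonneg (Real.sqrt_nonneg _)]
  exact inv_mul_le_one_of_le₀ hr (Real.sqrt_nonneg _)

lemma expNorm_add_le (u : E) {w : E} (hw : ‖w‖ ≤ 1 / 2) :
    expNorm (u + w) ≤
      expNorm u * (1 + inner ℝ ((√(1 + ‖u‖ ^ 2))⁻¹ • u) w + 3 * ‖w‖ ^ 2) := by
  set a := inner ℝ ((√(1 + ‖u‖ ^ 2))⁻¹ • u) w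
  set b := a + ‖w‖ ^ 2 / 2 with hb_eq
  have ha : |a| ≤ ‖w‖ := (abs_real_inner_le_norm _ _).trans
    (mul_le_of_le_one_left (norm_nonneg w) (norm_inv_sqrt_smul_le_one u))
  have hb : |b| ≤ 5 / 4 * ‖w‖ := by
    have := abs_add_le a (‖w‖ ^ 2 / 2)
    rw [abs_of_nonneg (by positivity : 0 ≤ ‖w‖ ^ 2 / 2)] at this
    nlinarith [norm_nonneg w]
  have hexp : Real.exp b ≤ 1 + b + b ^ 2 := by
    linarith [(abs_le.1 (Real.abs_exp_sub_one_sub_id_le (hb.trans (by linarith)))).2]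
  have hb_sq : b ^ 2 ≤ 25 / 16 * ‖w‖ ^ 2 := by
    nlinarith [sq_abs b, abs_nonneg b, norm_nonneg w]
  calc expNorm (u + w) ≤ Real.exp (√(1 + ‖u‖ ^ 2) + b) :=
        Real.exp_le_exp.2 (sqrt_one_add_sq_norm_add_le u w)
    _ = expNorm u * Real.exp b := Real.exp_add _ _
    _ ≤ expNorm u * (1 + a + 3 * ‖w‖ ^ 2) :=
        mul_le_mul_of_nonneg_left (by linarith [sq_nonneg ‖w‖]) (expNorm_pos u).le

lemma expect_expNorm_add_le {ι : Type*} [Fintype ι] [Nonempty ι] {w : ι → E}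
    (hw : ∑ i, w i = 0) (hw_le : ∀ i, ‖w i‖ ≤ 1 / 2) (u : E) :
    𝔼 i, expNorm (u + w i) ≤ expNorm u * (1 + 3 * 𝔼 i, ‖w i‖ ^ 2) := by
  set z := (√(1 + ‖u‖ ^ 2))⁻¹ • u
  have hcentred : 𝔼 i, inner ℝ z (w i) = 0 := by
    rw [Fintype.expect_eq_sum_div_card, ← inner_sum, hw, inner_zero_right, zero_div]
  calc 𝔼 i, expNorm (u + w i)
      ≤ 𝔼 i, expNorm u * (1 + inner ℝ z (w i) + 3 * ‖w i‖ ^ 2) :=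
        expect_le_expect fun i _ => expNorm_add_le u (hw_le i)
    _ = expNorm u * (1 + 3 * 𝔼 i, ‖w i‖ ^ 2) := by
        rw [← mul_expect, expect_add_distrib, expect_add_distrib, hcentred, Fintype.expect_const,
          ← mul_expect, add_zero]

section RecentredTail

/-- The family `v` without its member `v p`, shifted by `v p / n` so that its sum is that of `v`:
once a random permutation has put `p` first, the rest of it permutes this family uniformly. The
transposition `swap 0 p` matches `Equiv.Perm.decomposeFin`. -/
def recentredTail {n : ℕ} (v : Fin (n + 1) → E) (p : Fin (n + 1)) (m : Fin n) : E :=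
  v (Equiv.swap 0 p m.succ) + (n : ℝ)⁻¹ • v p

variable {n : ℕ}

lemma sum_swap_succ {M : Type*} [AddCommGroup M] (v : Fin (n + 1) → M) (p : Fin (n + 1)) :
    ∑ m : Fin n, v (Equiv.swap 0 p m.succ) = ∑ m, v m - v p := by
  rw [← Equiv.sum_comp (Equiv.swap 0 p) v, Fin.sum_univ_succ, Equiv.swap_apply_left,
    add_sub_cancel_left]

lemma sum_recentredTail {v : Fin (n + 1) → E} (hv : ∑ m, v m = 0) (p : Fin (n + 1)) :
    ∑ m, recentredTail v p m = 0 := by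
  rcases n.eq_zero_or_pos with rfl | hn
  · simp
  · have : (n : ℝ) ≠ 0 := by positivity
    simp [recentredTail, sum_add_distrib, sum_swap_succ, hv, ← Nat.cast_smul_eq_nsmul ℝ, this]

lemma sum_sq_norm_recentredTail_le {v : Fin (n + 1) → E} (hv : ∑ m, v m = 0) (p : Fin (n + 1)) :
    ∑ m, ‖recentredTail v p m‖ ^ 2 ≤ ∑ m, ‖v m‖ ^ 2 := by
  have hexpand : ∀ m, ‖recentredTail v p m‖ ^ 2 = ‖v (Equiv.swap 0 p m.succ)‖ ^ 2
      + 2 * (n : ℝ)⁻¹ * inner ℝ (v (Equiv.swap 0 p m.succ)) (v p)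
      + (n : ℝ)⁻¹ ^ 2 * ‖v p‖ ^ 2 := fun m => by
    rw [recentredTail, norm_add_sq_real, norm_smul, real_inner_smul_right, norm_inv,
      Real.norm_natCast]
    ring
  have hcross : ∑ m : Fin n, inner ℝ (v (Equiv.swap 0 p m.succ)) (v p) = -‖v p‖ ^ 2 := by
    rw [← sum_inner, sum_swap_succ, hv, zero_sub, inner_neg_left, real_inner_self_eq_norm_sq]
  have hconst : (n : ℝ)⁻¹ ^ 2 * (n * ‖v p‖ ^ 2) = (n : ℝ)⁻¹ * ‖v p‖ ^ 2 := by
    rcases n.eq_zero_or_pos with rfl | hn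
    · simp
    · field_simp
  have : 0 ≤ (n : ℝ)⁻¹ * ‖v p‖ ^ 2 := by positivity
  simp only [hexpand, sum_add_distrib, ← mul_sum, hcross, sum_swap_succ (fun m => ‖v m‖ ^ 2),
    sum_const, card_univ, Fintype.card_fin, nsmul_eq_mul, hconst]
  linarith [sq_nonneg ‖v p‖]

lemma partialSum_add_const (v : Fin n → E) (c : E) (k : Fin (n + 1)) :
    Fin.partialSum (fun m => v m + c) k = Fin.partialSum v k + (k : ℝ) • c := by
  induction k using Fin.induction with
  | zero => simp
  | succ k ih =>
    rw [Fin.partialSum_succ, Fin.partialSum_succ, ih, Fin.val_succ, Fin.val_castSucc]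
    push_cast
    module

lemma partialSum_comp_decomposeFin_symm (v : Fin (n + 1) → E) (p : Fin (n + 1))
    (e : Equiv.Perm (Fin n)) (k : Fin (n + 1)) :
    Fin.partialSum (v ∘ Equiv.Perm.decomposeFin.symm (p, e)) k.succ =
      (1 - (k : ℝ) / n) • v p + Fin.partialSum (recentredTail v p ∘ e) k := by
  have htail : (recentredTail v p ∘ e) =
      fun m => v (Equiv.swap 0 p (e m).succ) + (n : ℝ)⁻¹ • v p := rfl
  rw [Fin.partialSum_succ', htail, partialSum_add_const]
  simp only [Fin.tail_def, Function.comp_apply, Equiv.Perm.decomposeFin_symm_apply_zero,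
    Equiv.Perm.decomposeFin_symm_apply_succ]
  module

end RecentredTail

lemma sq_div_add_div_le {n k : ℕ} (hk : k ≤ n) :
    (1 - (k : ℝ) / n) ^ 2 / (n + 1 : ℕ) + k / n ≤ (k + 1 : ℕ) / (n + 1 : ℕ) := by
  rcases n.eq_zero_or_pos with rfl | hn
  · simp
  have hkn : (k : ℝ) ≤ n := mod_cast hk
  have hdiff : ((k + 1 : ℕ) : ℝ) / (n + 1 : ℕ) - ((1 - (k : ℝ) / n) ^ 2 / (n + 1 : ℕ) + k / n) =
      k / n * (n - k) / (n * (n + 1)) := by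
    push_cast; field_simp; ring
  have : (0 : ℝ) ≤ k / n * (n - k) / (n * (n + 1)) :=
    div_nonneg (mul_nonneg (by positivity) (by linarith)) (by positivity)
  linarith

lemma expect_expNorm_add_smul_le {n : ℕ} {v : Fin (n + 1) → E} (hv : ∑ m, v m = 0)
    (hQ : ∑ m, ‖v m‖ ^ 2 ≤ 1 / 4) (u : E) {c : ℝ} (hc₀ : 0 ≤ c) (hc₁ : c ≤ 1) :
    𝔼 p, expNorm (u + c • v p) ≤
      expNorm u * Real.exp (3 * (∑ m, ‖v m‖ ^ 2) * (c ^ 2 / (n + 1 : ℕ))) := by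
  have hnorm : ∀ p, ‖c • v p‖ = c * ‖v p‖ := fun p => by rw [norm_smul, Real.norm_of_nonneg hc₀]
  have hmean := expect_expNorm_add_le (w := fun p => c • v p) (by rw [← smul_sum, hv, smul_zero])
    (fun p => by
      rw [hnorm]
      exact (mul_le_of_le_one_left (norm_nonneg _) hc₁).trans
        (norm_le_half_of_sum_sq_norm_le hQ p)) u
  refine hmean.trans (mul_le_mul_of_nonneg_left ?_ (expNorm_pos u).le)
  have hvar : 3 * 𝔼 p, ‖c • v p‖ ^ 2 = 3 * (∑ m, ‖v m‖ ^ 2) * (c ^ 2 / (n + 1 : ℕ)) := by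
    simp only [hnorm, mul_pow, ← mul_expect, Fintype.expect_eq_sum_div_card, Fintype.card_fin]
    ring
  linarith [Real.add_one_le_exp (3 * (∑ m, ‖v m‖ ^ 2) * (c ^ 2 / (n + 1 : ℕ)))]

theorem expect_expNorm_add_partialSum_le {n : ℕ} {v : Fin n → E} (hv : ∑ m, v m = 0)
    (hQ : ∑ m, ‖v m‖ ^ 2 ≤ 1 / 4) (u : E) (k : Fin (n + 1)) :
    𝔼 σ : Equiv.Perm (Fin n), expNorm (u + Fin.partialSum (v ∘ σ) k) ≤
      expNorm u * Real.exp (3 * (∑ m, ‖v m‖ ^ 2) * (k / n)) := by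
  induction n generalizing u with
  | zero => simp [Fin.fin_one_eq_zero k]
  | succ n ih =>
    cases k using Fin.cases with
    | zero => simp
    | succ k =>
      set Q := ∑ m, ‖v m‖ ^ 2
      have : 0 ≤ Q := sum_nonneg fun _ _ => by positivity
      have hkn : (k : ℝ) / n ≤ 1 := div_le_one_of_le₀ (mod_cast k.is_le) (by positivity)
      have hrest : ∀ p, 𝔼 e : Equiv.Perm (Fin n),
          expNorm (u + Fin.partialSum (v ∘ Equiv.Perm.decomposeFin.symm (p, e)) k.succ) ≤
            expNorm (u + (1 - (k : ℝ) / n) • v p) * Real.exp (3 * Q * (k / n)) := fun p => by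
        have hQ_tail := sum_sq_norm_recentredTail_le hv p
        simp only [partialSum_comp_decomposeFin_symm, ← add_assoc]
        refine (ih (sum_recentredTail hv p) (hQ_tail.trans hQ) _ k).trans ?_
        gcongr
        exact (expNorm_pos _).le
      calc 𝔼 σ : Equiv.Perm (Fin (n + 1)), expNorm (u + Fin.partialSum (v ∘ σ) k.succ)
          = 𝔼 p, 𝔼 e : Equiv.Perm (Fin n),
              expNorm (u + Fin.partialSum (v ∘ Equiv.Perm.decomposeFin.symm (p, e)) k.succ) := by
            rw [← expect_product', univ_product_univ]
            exact Fintype.expect_equiv Equiv.Perm.decomposeFin _ _ fun σ => by simp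
        _ ≤ (𝔼 p, expNorm (u + (1 - (k : ℝ) / n) • v p)) * Real.exp (3 * Q * (k / n)) := by
            rw [expect_mul]
            exact expect_le_expect fun p _ => hrest p
        _ ≤ expNorm u * Real.exp (3 * Q * ((1 - (k : ℝ) / n) ^ 2 / (n + 1 : ℕ))) *
              Real.exp (3 * Q * (k / n)) := by
            gcongr
            exact expect_expNorm_add_smul_le hv hQ u (sub_nonneg.2 hkn)
              (sub_le_self 1 (by positivity))
        _ = expNorm u * Real.exp (3 * Q * ((1 - (k : ℝ) / n) ^ 2 / (n + 1 : ℕ) + k / n)) := by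
            rw [mul_add, Real.exp_add, mul_assoc]
        _ ≤ expNorm u * Real.exp (3 * Q * ((k.succ : ℕ) / (n + 1 : ℕ))) := by
            rw [Fin.val_succ]
            gcongr
            · exact (expNorm_pos u).le
            · exact sq_div_add_div_le k.is_le

lemma dens_mul_le_expect {ι : Type*} [Fintype ι] [Nonempty ι] {g : ι → ℝ} (hg : ∀ i, 0 ≤ g i)
    (c : ℝ) : (({i | c ≤ g i} : Finset ι).dens : ℝ) * c ≤ 𝔼 i, g i := by
  rw [nnratCast_dens, Fintype.expect_eq_sum_div_card, div_mul_eq_mul_div, ← nsmul_eq_mul]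
  gcongr
  exact (card_nsmul_le_sum _ _ _ fun i hi => (mem_filter.1 hi).2).trans
    (sum_le_univ_sum_of_nonneg hg)

lemma dens_le_norm_partialSum_le_of_sum_sq_eq {n : ℕ} {v : Fin n → E} (hv : ∑ m, v m = 0)
    (hQ : ∑ m, ‖v m‖ ^ 2 = 1 / 4) (k : Fin (n + 1)) (l : ℝ) :
    (({σ | l ≤ ‖Fin.partialSum (v ∘ σ) k‖} : Finset (Equiv.Perm (Fin n))).dens : ℝ) ≤
      8 * Real.exp (-l) := by
  have hkn : (k : ℝ) / n ≤ 1 := div_le_one_of_le₀ (mod_cast k.is_le) (by positivity)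
  have hmoment : 𝔼 σ : Equiv.Perm (Fin n), expNorm (Fin.partialSum (v ∘ σ) k) ≤ 8 :=
    calc 𝔼 σ : Equiv.Perm (Fin n), expNorm (Fin.partialSum (v ∘ σ) k)
        ≤ Real.exp 1 * Real.exp (3 * (1 / 4) * (k / n)) := by
          simpa [hQ] using expect_expNorm_add_partialSum_le hv hQ.le 0 k
      _ ≤ Real.exp 1 * Real.exp 1 := by gcongr; linarith
      _ ≤ 8 := by nlinarith [Real.exp_one_lt_d9, Real.exp_pos 1]
  have hsub : ({σ | l ≤ ‖Fin.partialSum (v ∘ σ) k‖} : Finset (Equiv.Perm (Fin n))) ⊆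
      ({σ | Real.exp l ≤ expNorm (Fin.partialSum (v ∘ σ) k)} : Finset (Equiv.Perm (Fin n))) :=
    monotone_filter_right _ fun σ _ hσ =>
      (Real.exp_le_exp.2 hσ).trans (exp_norm_le_expNorm _)
  rw [Real.exp_neg, ← div_eq_mul_inv, le_div_iff₀ (Real.exp_pos l)]
  refine le_trans ?_ ((dens_mul_le_expect (fun σ : Equiv.Perm (Fin n) =>
    (expNorm_pos (Fin.partialSum (v ∘ σ) k)).le) (Real.exp l)).trans hmoment)
  gcongr

lemma partialSum_smul {n : ℕ} (r : ℝ) (v : Fin n → E) (k : Fin (n + 1)) :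
    Fin.partialSum (fun m => r • v m) k = r • Fin.partialSum v k := by
  induction k using Fin.induction with
  | zero => simp
  | succ k ih => rw [Fin.partialSum_succ, Fin.partialSum_succ, ih, smul_add]

theorem dens_lt_norm_partialSum_le {n : ℕ} {v : Fin n → E} (hv : ∑ m, v m = 0) (k : Fin (n + 1))
    (l : ℝ) :
    (({σ | 2 * l * √(∑ m, ‖v m‖ ^ 2) < ‖Fin.partialSum (v ∘ σ) k‖} :
      Finset (Equiv.Perm (Fin n))).dens : ℝ) ≤ 8 * Real.exp (-l) := by
  set Q := ∑ m, ‖v m‖ ^ 2 with hQ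
  have hQ_nonneg : 0 ≤ Q := sum_nonneg fun _ _ => by positivity
  rcases hQ_nonneg.eq_or_lt with hQ₀ | hQ₀
  · have hv₀ : v = fun _ => (0 : ℝ) • (0 : E) := by
      funext m
      simpa using (sum_eq_zero_iff_of_nonneg fun _ _ => by positivity).1 hQ₀.symm m (mem_univ m)
    have hzero : ∀ σ : Equiv.Perm (Fin n), Fin.partialSum (v ∘ σ) k = 0 := fun σ => by
      rw [hv₀]
      exact (partialSum_smul 0 0 k).trans (zero_smul ℝ _)
    simp only [hzero, ← hQ₀, Real.sqrt_zero, mul_zero, norm_zero, lt_self_iff_false,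
      filter_false, dens_empty, NNRat.cast_zero]
    positivity
  · set r := (2 * √Q)⁻¹ with hr
    have hr₀ : 0 < r := by positivity
    have hQ_scaled : ∑ m, ‖r • v m‖ ^ 2 = 1 / 4 := by
      simp only [norm_smul, mul_pow, ← mul_sum, Real.norm_of_nonneg hr₀.le, ← hQ]
      rw [hr, inv_pow, mul_pow, Real.sq_sqrt hQ_nonneg]
      field_simp
      norm_num
    refine le_trans ?_ (dens_le_norm_partialSum_le_of_sum_sq_eq
      (by rw [← smul_sum, hv, smul_zero]) hQ_scaled k l)
    gcongr with σ
    intro hσ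
    change l ≤ ‖Fin.partialSum (fun m => r • (v ∘ σ) m) k‖
    rw [partialSum_smul, norm_smul, Real.norm_of_nonneg hr₀.le, hr, ← div_eq_inv_mul,
      le_div_iff₀ (by positivity)]
    linarith

end Concentration

section Smooth

variable {E : Type*} [NormedAddCommGroup E] [InnerProductSpace ℝ E] [CompleteSpace E]

lemma hasDerivAt_comp_add_smul {f : E → ℝ} (hf : Differentiable ℝ f) (x w : E) (s : ℝ) :
    HasDerivAt (fun s : ℝ => f (x + s • w)) (inner ℝ (gradient f (x + s • w)) w) s := by
  have hline : HasDerivAt (fun s : ℝ => x + s • w) w s := by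
    simpa using ((hasDerivAt_id s).smul_const w).const_add x
  rw [inner_gradient_left]
  exact (hf (x + s • w)).hasFDerivAt.comp_hasDerivAt s hline

theorem le_add_inner_gradient_add_sq {f : E → ℝ} {L : ℝ≥0} (hf : Differentiable ℝ f)
    (hL : LipschitzWith L (gradient f)) (x w : E) :
    f (x + w) ≤ f x + inner ℝ (gradient f x) w + L / 2 * ‖w‖ ^ 2 := by
  set h : ℝ → ℝ := fun s =>
    f (x + s • w) - s * inner ℝ (gradient f x) w - L / 2 * ‖w‖ ^ 2 * s ^ 2 with hh
  have hderiv : ∀ s, HasDerivAt h (inner ℝ (gradient f (x + s • w)) w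
      - inner ℝ (gradient f x) w - L / 2 * ‖w‖ ^ 2 * (2 * s)) s := fun s => by
    have hlin := (hasDerivAt_id s).mul_const (inner ℝ (gradient f x) w)
    have hquad := ((hasDerivAt_id s).pow 2).const_mul (L / 2 * ‖w‖ ^ 2)
    exact (((hasDerivAt_comp_add_smul hf x w s).sub hlin).sub hquad).congr_deriv (by simp)
  have hanti : AntitoneOn h (Set.Icc 0 1) := by
    refine antitoneOn_of_deriv_nonpos (convex_Icc 0 1)
      (fun s _ => (hderiv s).continuousAt.continuousWithinAt)
      (fun s _ => (hderiv s).differentiableAt.differentiableWithinAt) fun s hs => ?_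
    rw [interior_Icc] at hs
    rw [(hderiv s).deriv, ← inner_sub_left]
    have hinner := real_inner_le_norm (gradient f (x + s • w) - gradient f x) w
    have hlip := hL.norm_sub_le (x + s • w) x
    rw [add_sub_cancel_left, norm_smul, Real.norm_of_nonneg hs.1.le] at hlip
    nlinarith [mul_le_mul_of_nonneg_right hlip (norm_nonneg w)]
  have h_le : h 1 ≤ h 0 := hanti (by simp) (by simp) zero_le_one
  simp only [hh, one_smul, zero_smul, add_zero] at h_le
  linarith

theorem sq_norm_gradient_le {f : E → ℝ} {L : ℝ≥0} (hL₀ : 0 < L) (hf : Differentiable ℝ f)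
    (hL : LipschitzWith L (gradient f)) {b : ℝ} (hb : ∀ x, b ≤ f x) (x : E) :
    ‖gradient f x‖ ^ 2 ≤ 2 * L * (f x - b) := by
  have hL₀' : (0 : ℝ) < L := hL₀
  have h := (hb _).trans (le_add_inner_gradient_add_sq hf hL x (-((L : ℝ)⁻¹ • gradient f x)))
  rw [inner_neg_right, real_inner_smul_right, real_inner_self_eq_norm_sq, norm_neg, norm_smul,
    norm_inv, Real.norm_of_nonneg hL₀'.le] at h
  have hquad : (L : ℝ) / 2 * ((L : ℝ)⁻¹ * ‖gradient f x‖) ^ 2 =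
      (L : ℝ)⁻¹ * ‖gradient f x‖ ^ 2 / 2 := by field_simp
  have hdiv : (L : ℝ)⁻¹ * ‖gradient f x‖ ^ 2 ≤ 2 * (f x - b) := by linarith
  rw [inv_mul_le_iff₀ hL₀'] at hdiv
  linarith

theorem apply_sub_smul_gradient_add_le {f : E → ℝ} {L : ℝ≥0} (hf : Differentiable ℝ f)
    (hL : LipschitzWith L (gradient f)) {η : ℝ} (hη₀ : 0 ≤ η) (hη : η * L ≤ 1) (x r : E) :
    f (x - η • (gradient f x + r)) ≤
      f x - η / 2 * ‖gradient f x‖ ^ 2 + η / 2 * ‖r‖ ^ 2 := by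
  set G := gradient f x
  have h := le_add_inner_gradient_add_sq hf hL x (-(η • (G + r)))
  rw [← sub_eq_add_neg, inner_neg_right, real_inner_smul_right, norm_neg, norm_smul,
    Real.norm_of_nonneg hη₀, mul_pow] at h
  have hquad : (L : ℝ) / 2 * (η ^ 2 * ‖G + r‖ ^ 2) ≤ η / 2 * ‖G + r‖ ^ 2 := by
    have := mul_le_mul_of_nonneg_right hη (by positivity : 0 ≤ η / 2 * ‖G + r‖ ^ 2)
    linarith
  have hpolar : ‖r‖ ^ 2 = ‖G + r‖ ^ 2 - 2 * inner ℝ G (G + r) + ‖G‖ ^ 2 := by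
    rw [norm_add_sq_real, inner_add_right, real_inner_self_eq_norm_sq]; ring
  rw [hpolar]
  linarith

end Smooth

section Mean

/-- The pointwise average of finitely many functions: the finite-sum objective, or its gradient
field. The scalars are real because a general real vector space has no `ℚ≥0`-module structure for
`Finset.expect`. -/
def mean {n : ℕ} {X M : Type*} [AddCommGroup M] [Module ℝ M] (g : Fin n → X → M) (x : X) : M :=
  (n : ℝ)⁻¹ • ∑ i, g i x

/-- How far each member of a finite family of functions is from the average of the family. -/
def deviation {n : ℕ} {X M : Type*} [AddCommGroup M] [Module ℝ M] (g : Fin n → X → M) (x : X)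
    (i : Fin n) : M :=
  g i x - mean g x

section Module

variable {n : ℕ} {X M : Type*} [AddCommGroup M] [Module ℝ M]

lemma natCast_smul_mean (g : Fin n → X → M) (x : X) : (n : ℝ) • mean g x = ∑ i, g i x := by
  rcases n.eq_zero_or_pos with rfl | hn
  · simp
  · exact smul_inv_smul₀ (by positivity) _

lemma sum_deviation (g : Fin n → X → M) (x : X) : ∑ i, deviation g x i = 0 := by
  simp [deviation, sum_sub_distrib, ← natCast_smul_mean, Nat.cast_smul_eq_nsmul]

end Module

lemma lipschitzWith_mean {n : ℕ} {X M : Type*} [PseudoMetricSpace X] [NormedAddCommGroup M]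
    [NormedSpace ℝ M] {g : Fin n → X → M} {K : ℝ≥0} (hg : ∀ i, LipschitzWith K (g i)) :
    LipschitzWith K (mean g) := by
  rcases n.eq_zero_or_pos with rfl | hn
  · exact LipschitzWith.of_dist_le_mul fun x y => by simp [mean, mul_nonneg]
  refine LipschitzWith.of_dist_le_mul fun x y => ?_
  rw [dist_eq_norm, mean, mean, ← smul_sub, ← sum_sub_distrib, norm_smul, norm_inv,
    Real.norm_natCast, inv_mul_le_iff₀ (by positivity)]
  calc ‖∑ i, (g i x - g i y)‖ ≤ ∑ i, ‖g i x - g i y‖ := norm_sum_le _ _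
    _ ≤ ∑ _i : Fin n, K * dist x y :=
        sum_le_sum fun i _ => dist_eq_norm (g i x) (g i y) ▸ (hg i).dist_le_mul x y
    _ = n * (K * dist x y) := by simp

variable {E : Type*} [NormedAddCommGroup E] [InnerProductSpace ℝ E]

lemma sum_sq_norm_deviation_le {n : ℕ} {X : Type*} (g : Fin n → X → E) (x : X) :
    ∑ i, ‖deviation g x i‖ ^ 2 ≤ ∑ i, ‖g i x‖ ^ 2 := by
  have hexpand : ∀ i, ‖deviation g x i‖ ^ 2 =
      ‖g i x‖ ^ 2 - 2 * inner ℝ (g i x) (mean g x) + ‖mean g x‖ ^ 2 := fun i =>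
    norm_sub_sq_real _ _
  have hcross : ∑ i, inner ℝ (g i x) (mean g x) = n * ‖mean g x‖ ^ 2 := by
    rw [← sum_inner, ← natCast_smul_mean, real_inner_smul_left, real_inner_self_eq_norm_sq]
  have : 0 ≤ n * ‖mean g x‖ ^ 2 := by positivity
  simp only [hexpand, sum_add_distrib, sum_sub_distrib, ← mul_sum, hcross, sum_const, card_univ,
    Fintype.card_fin, nsmul_eq_mul]
  linarith

variable [CompleteSpace E] {n : ℕ} {f : Fin n → E → ℝ}

lemma hasGradientAt_mean (hf : ∀ i, Differentiable ℝ (f i)) (x : E) :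
    HasGradientAt (mean f) (mean (fun i => gradient (f i)) x) x := by
  have hsum : HasFDerivAt (fun y => ∑ i, f i y)
      (∑ i, InnerProductSpace.toDual ℝ E (gradient (f i) x)) x :=
    HasFDerivAt.fun_sum fun i _ => (hf i x).hasGradientAt.hasFDerivAt
  rw [hasGradientAt_iff_hasFDerivAt, mean, map_smul, map_sum]
  exact hsum.const_smul (n : ℝ)⁻¹

lemma gradient_mean (hf : ∀ i, Differentiable ℝ (f i)) (x : E) :
    gradient (mean f) x = mean (fun i => gradient (f i)) x :=
  (hasGradientAt_mean hf x).gradient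

lemma lipschitzWith_gradient_mean {L : ℝ≥0} (hf : ∀ i, Differentiable ℝ (f i))
    (hL : ∀ i, LipschitzWith L (gradient (f i))) : LipschitzWith L (gradient (mean f)) := by
  rw [funext (gradient_mean hf)]
  exact lipschitzWith_mean hL

end Mean

section Gap

variable {n : ℕ} {X : Type*} {f : Fin n → X → ℝ} {lb : Fin n → ℝ}

/-- The average distance of the components to their lower bounds. It differs from `mean f` by a
constant and is the Lyapunov function of the analysis. -/
def gap (f : Fin n → X → ℝ) (lb : Fin n → ℝ) (x : X) : ℝ :=
  mean f x - (n : ℝ)⁻¹ * ∑ i, lb i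

lemma natCast_mul_gap (f : Fin n → X → ℝ) (lb : Fin n → ℝ) (x : X) :
    n * gap f lb x = ∑ i, (f i x - lb i) := by
  rw [gap, mul_sub, ← smul_eq_mul, natCast_smul_mean, sum_sub_distrib]
  rcases n.eq_zero_or_pos with rfl | hn
  · simp
  · field_simp

lemma gap_nonneg (hlb : ∀ i x, lb i ≤ f i x) (x : X) : 0 ≤ gap f lb x := by
  rw [gap, mean, smul_eq_mul, ← mul_sub, ← sum_sub_distrib]
  exact mul_nonneg (by positivity) (sum_nonneg fun i _ => sub_nonneg.2 (hlb i x))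

variable {E : Type*} [NormedAddCommGroup E] [InnerProductSpace ℝ E] [CompleteSpace E]

lemma sum_sq_norm_deviation_gradient_le {f : Fin n → E → ℝ} {L : ℝ≥0} (hL₀ : 0 < L)
    (hf : ∀ i, Differentiable ℝ (f i)) (hL : ∀ i, LipschitzWith L (gradient (f i)))
    (hlb : ∀ i x, lb i ≤ f i x) (x : E) :
    ∑ i, ‖deviation (fun i => gradient (f i)) x i‖ ^ 2 ≤ 2 * L * (n * gap f lb x) :=
  calc ∑ i, ‖deviation (fun i => gradient (f i)) x i‖ ^ 2
      ≤ ∑ i, ‖gradient (f i) x‖ ^ 2 := sum_sq_norm_deviation_le _ x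
    _ ≤ ∑ i, 2 * L * (f i x - lb i) :=
        sum_le_sum fun i _ => sq_norm_gradient_le hL₀ (hf i) (hL i) (hlb i) x
    _ = 2 * L * (n * gap f lb x) := by rw [← mul_sum, natCast_mul_gap]

end Gap

section Pass

lemma norm_partialSum_le {E : Type*} [SeminormedAddCommGroup E] {n : ℕ} {v : Fin n → E}
    {k : Fin (n + 1)} {c : ℝ}
    (hv : ∀ j : Fin n, j.castSucc < k → ‖v j‖ ≤ c) : ‖Fin.partialSum v k‖ ≤ k * c := by
  induction k using Fin.induction with
  | zero => simp
  | succ k ih =>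
    rw [Fin.partialSum_succ, Fin.val_succ]
    push_cast
    rw [add_one_mul]
    exact (norm_add_le _ _).trans (add_le_add
      (ih fun j hj => hv j (hj.trans k.castSucc_lt_succ)) (hv k k.castSucc_lt_succ))

variable {E : Type*} [NormedAddCommGroup E] [NormedSpace ℝ E] {n : ℕ}

/-- The points visited by one pass with step size `α` along the fields `h 0, h 1, …`, in this
order, from `x` on. -/
def pass (α : ℝ) (h : Fin n → E → E) (x : E) : Fin (n + 1) → E :=
  Fin.induction x fun j y => y - α • h j y

@[simp] lemma pass_zero (α : ℝ) (h : Fin n → E → E) (x : E) : pass α h x 0 = x := rfl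

lemma pass_succ (α : ℝ) (h : Fin n → E → E) (x : E) (j : Fin n) :
    pass α h x j.succ = pass α h x j.castSucc - α • h j (pass α h x j.castSucc) :=
  Fin.induction_succ _ _ _

lemma pass_add_smul_partialSum_eq (α : ℝ) (h : Fin n → E → E) (x : E) (k : Fin (n + 1)) :
    pass α h x k + α • Fin.partialSum (fun j => h j x) k =
      x - α • Fin.partialSum (fun j => h j (pass α h x j.castSucc) - h j x) k := by
  induction k using Fin.induction with
  | zero => simp
  | succ k ih =>
    rw [Fin.partialSum_succ, Fin.partialSum_succ, pass_succ, smul_add, smul_add, ← sub_sub, ← ih]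
    module

variable {α S : ℝ} {L : ℝ≥0} {h : Fin n → E → E} {x : E}

lemma norm_pass_add_smul_partialSum_sub_le (hα : 0 ≤ α) (hL : ∀ j, LipschitzWith L (h j)) {D : ℝ}
    {k : Fin (n + 1)} (hD : ∀ j : Fin n, j.castSucc < k → ‖pass α h x j.castSucc - x‖ ≤ D) :
    ‖pass α h x k + α • Fin.partialSum (fun j => h j x) k - x‖ ≤ α * (k * (L * D)) := by
  rw [pass_add_smul_partialSum_eq, sub_sub_cancel_left, norm_neg, norm_smul,
    Real.norm_of_nonneg hα]
  gcongr
  refine norm_partialSum_le fun j hj => ((hL j).norm_sub_le _ _).trans ?_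
  gcongr
  exact hD j hj

/-- Strong induction along the pass: while the pass has stayed within `4/3 α S` of `x`, the fields
have moved by at most `4/3 α S L`, which costs at most another quarter of that radius. -/
lemma norm_pass_sub_le (hα : 0 ≤ α) (hαL : 4 * (α * (n * L)) ≤ 1)
    (hL : ∀ j, LipschitzWith L (h j))
    (hS : ∀ j : Fin n, ‖Fin.partialSum (fun j => h j x) j.castSucc‖ ≤ S) (k : Fin n) :
    ‖pass α h x k.castSucc - x‖ ≤ 4 / 3 * (α * S) := by
  have hS₀ : 0 ≤ α * S := mul_nonneg hα ((norm_nonneg _).trans (hS k))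
  induction k using WellFoundedLT.induction with
  | ind k ih =>
    have hdrift := norm_pass_add_smul_partialSum_sub_le (k := k.castSucc) hα hL fun j hj =>
      ih j (Fin.castSucc_lt_castSucc_iff.1 hj)
    have hsum : ‖α • Fin.partialSum (fun j => h j x) k.castSucc‖ ≤ α * S := by
      rw [norm_smul, Real.norm_of_nonneg hα]
      gcongr
      exact hS k
    have hkn : (k.castSucc : ℝ) ≤ n := mod_cast k.castSucc.is_le
    calc ‖pass α h x k.castSucc - x‖
        ≤ ‖pass α h x k.castSucc + α • Fin.partialSum (fun j => h j x) k.castSucc - x‖ +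
            ‖α • Fin.partialSum (fun j => h j x) k.castSucc‖ := by
          rw [add_sub_right_comm]; exact norm_le_add_norm_add _ _
      _ ≤ α * (n * (L * (4 / 3 * (α * S)))) + α * S :=
          add_le_add (hdrift.trans (by gcongr)) hsum
      _ = 4 * (α * (n * L)) * (1 / 3 * (α * S)) + α * S := by ring
      _ ≤ 1 * (1 / 3 * (α * S)) + α * S := by gcongr
      _ = 4 / 3 * (α * S) := by ring

end Pass

section GapPass

variable {E : Type*} [NormedAddCommGroup E] [InnerProductSpace ℝ E] {n : ℕ}

/-- The order `σ` is balanced at `x` with parameter `l` if all proper partial sums of the deviations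
of the fields `g` at `x`, taken in this order, are at most `2 l` times the root of the total squared
deviation. -/
def IsBalanced (g : Fin n → E → E) (l : ℝ) (x : E) (σ : Equiv.Perm (Fin n)) : Prop :=
  ∀ k : Fin n, ‖Fin.partialSum (deviation g x ∘ σ) k.castSucc‖ ≤
    2 * l * √(∑ i, ‖deviation g x i‖ ^ 2)

lemma dens_not_isBalanced_le (g : Fin n → E → E) (l : ℝ) (x : E)
    [DecidablePred (IsBalanced g l x)] :
    (({σ | ¬ IsBalanced g l x σ} : Finset (Equiv.Perm (Fin n))).dens : ℝ) ≤
      n * (8 * Real.exp (-l)) := by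
  have hsub : ({σ | ¬ IsBalanced g l x σ} : Finset (Equiv.Perm (Fin n))) ⊆
      univ.biUnion fun k : Fin n => {σ | 2 * l * √(∑ i, ‖deviation g x i‖ ^ 2) <
        ‖Fin.partialSum (deviation g x ∘ σ) k.castSucc‖} := fun σ => by
    simp [IsBalanced]
  calc (({σ | ¬ IsBalanced g l x σ} : Finset (Equiv.Perm (Fin n))).dens : ℝ)
      ≤ ∑ k : Fin n, (({σ | 2 * l * √(∑ i, ‖deviation g x i‖ ^ 2) <
          ‖Fin.partialSum (deviation g x ∘ σ) k.castSucc‖} :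
            Finset (Equiv.Perm (Fin n))).dens : ℝ) := by
        exact_mod_cast (dens_le_dens hsub).trans dens_biUnion_le
    _ ≤ ∑ _k : Fin n, 8 * Real.exp (-l) :=
        sum_le_sum fun k _ => dens_lt_norm_partialSum_le (sum_deviation g x) k.castSucc l
    _ = n * (8 * Real.exp (-l)) := by simp

lemma partialSum_comp_perm_eq (g : Fin n → E → E) (x : E) (σ : Equiv.Perm (Fin n))
    (k : Fin (n + 1)) :
    Fin.partialSum (fun j => g (σ j) x) k =
      Fin.partialSum (deviation g x ∘ σ) k + (k : ℝ) • mean g x := by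
  rw [← partialSum_add_const]
  simp [deviation]

lemma partialSum_last {M : Type*} [AddCommMonoid M] (v : Fin n → M) :
    Fin.partialSum v (Fin.last n) = ∑ j, v j := by
  rw [Fin.partialSum, List.take_of_length_le (by simp), List.sum_ofFn]

lemma norm_partialSum_comp_perm_le {g : Fin n → E → E} {x : E} {σ : Equiv.Perm (Fin n)} {R : ℝ}
    (hR : ∀ k : Fin n, ‖Fin.partialSum (deviation g x ∘ σ) k.castSucc‖ ≤ R) (k : Fin n) :
    ‖Fin.partialSum (fun j => g (σ j) x) k.castSucc‖ ≤ R + n * ‖mean g x‖ := by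
  rw [partialSum_comp_perm_eq]
  refine (norm_add_le _ _).trans (add_le_add (hR k) ?_)
  rw [norm_smul, Real.norm_natCast]
  gcongr
  exact k.castSucc.is_le

lemma exists_pass_last_eq {g : Fin n → E → E} {L : ℝ≥0} {α R : ℝ} {x : E}
    {σ : Equiv.Perm (Fin n)} (hn : 0 < n) (hα : 0 ≤ α) (hαL : 4 * (α * (n * L)) ≤ 1)
    (hL : ∀ i, LipschitzWith L (g i))
    (hR : ∀ k : Fin n, ‖Fin.partialSum (deviation g x ∘ σ) k.castSucc‖ ≤ R) :
    ∃ r : E, pass α (g ∘ σ) x (Fin.last n) = x - (n * α) • (mean g x + r) ∧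
      ‖r‖ ≤ L * (4 / 3 * (α * (R + n * ‖mean g x‖))) := by
  set S := R + n * ‖mean g x‖
  have hn' : (n : ℝ) ≠ 0 := by positivity
  set e := Fin.partialSum
    (fun j => g (σ j) (pass α (g ∘ σ) x j.castSucc) - g (σ j) x) (Fin.last n)
  have he_norm : ‖e‖ ≤ n * (L * (4 / 3 * (α * S))) :=
    (norm_partialSum_le fun j _ => ((hL (σ j)).norm_sub_le _ _).trans <|
      mul_le_mul_of_nonneg_left (norm_pass_sub_le hα hαL (fun j => hL (σ j))
        (norm_partialSum_comp_perm_le hR) j) L.coe_nonneg).trans_eq (by rw [Fin.val_last])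
  refine ⟨(n : ℝ)⁻¹ • e, ?_, ?_⟩
  · have hpass := pass_add_smul_partialSum_eq α (g ∘ σ) x (Fin.last n)
    have hsum : Fin.partialSum (fun j => (g ∘ σ) j x) (Fin.last n) = (n : ℝ) • mean g x := by
      rw [partialSum_last, natCast_smul_mean]
      exact Equiv.sum_comp σ fun i => g i x
    rw [hsum, ← eq_sub_iff_add_eq] at hpass
    rw [hpass, mul_comm (n : ℝ) α, mul_smul, smul_add, smul_inv_smul₀ hn', smul_add, ← sub_sub,
      sub_right_comm]
    rfl
  · rwa [norm_smul, norm_inv, Real.norm_natCast, inv_mul_le_iff₀ (by positivity)]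

variable [CompleteSpace E] {f : Fin n → E → ℝ} {lb : Fin n → ℝ} {L : ℝ≥0} {α l : ℝ} {x : E}
  {σ : Equiv.Perm (Fin n)}

lemma gap_pass_add_le {R : ℝ} (hn : 0 < n) (hα : 0 ≤ α) (hαL : 4 * (α * (n * L)) ≤ 1)
    (hf : ∀ i, Differentiable ℝ (f i)) (hL : ∀ i, LipschitzWith L (gradient (f i)))
    (hR : ∀ k : Fin n,
      ‖Fin.partialSum (deviation (fun i => gradient (f i)) x ∘ σ) k.castSucc‖ ≤ R) :
    gap f lb (pass α ((fun i => gradient (f i)) ∘ σ) x (Fin.last n)) +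
        n * α / 3 * ‖gradient (mean f) x‖ ^ 2 ≤
      gap f lb x + 2 * (n * α ^ 3 * L ^ 2 * R ^ 2) := by
  have hαnL₀ : 0 ≤ α * (n * L) := by positivity
  set G := gradient (mean f) x with hG
  obtain ⟨r, hpass, hr⟩ := exists_pass_last_eq hn hα hαL hL hR
  rw [← gradient_mean hf, ← hG] at hpass hr
  have hdescent : mean f (x - (n * α) • (G + r)) ≤
      mean f x - n * α / 2 * ‖G‖ ^ 2 + n * α / 2 * ‖r‖ ^ 2 :=
    apply_sub_smul_gradient_add_le (fun y => (hasGradientAt_mean hf y).differentiableAt)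
      (lipschitzWith_gradient_mean hf hL) (by positivity) (by linarith) x r
  have hr_sq : ‖r‖ ^ 2 ≤ 32 / 9 * (α ^ 2 * L ^ 2 * R ^ 2 + (α * (n * L)) ^ 2 * ‖G‖ ^ 2) :=
    calc ‖r‖ ^ 2 ≤ (L * (4 / 3 * (α * (R + n * ‖G‖)))) ^ 2 := by gcongr
      _ = 16 / 9 * (α ^ 2 * L ^ 2) * (R + n * ‖G‖) ^ 2 := by ring
      _ ≤ 16 / 9 * (α ^ 2 * L ^ 2) * (2 * (R ^ 2 + (n * ‖G‖) ^ 2)) := by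
          gcongr; exact add_sq_le
      _ = _ := by ring
  have hαnL : (α * (n * L)) ^ 2 ≤ 1 / 16 := by nlinarith
  have hr_cost : n * α / 2 * ‖r‖ ^ 2 ≤
      16 / 9 * (n * α ^ 3 * L ^ 2 * R ^ 2) + n * α / 9 * ‖G‖ ^ 2 :=
    calc n * α / 2 * ‖r‖ ^ 2
        ≤ n * α / 2 * (32 / 9 * (α ^ 2 * L ^ 2 * R ^ 2 + 1 / 16 * ‖G‖ ^ 2)) := by
          gcongr; exact hr_sq.trans (by gcongr)
      _ = _ := by ring
  have : 0 ≤ n * α ^ 3 * L ^ 2 * R ^ 2 := by positivity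
  have : 0 ≤ n * α * ‖G‖ ^ 2 := by positivity
  rw [hpass, gap, gap]
  linarith

theorem gap_pass_add_le_of_isBalanced (hL₀ : 0 < L) (hn : 0 < n) (hα : 0 ≤ α)
    (hαL : 4 * (α * (n * L)) ≤ 1)
    (hf : ∀ i, Differentiable ℝ (f i)) (hL : ∀ i, LipschitzWith L (gradient (f i)))
    (hlb : ∀ i x, lb i ≤ f i x)
    (hσ : IsBalanced (fun i => gradient (f i)) l x σ) :
    gap f lb (pass α ((fun i => gradient (f i)) ∘ σ) x (Fin.last n)) +
        n * α / 3 * ‖gradient (mean f) x‖ ^ 2 ≤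
      (1 + 16 * α ^ 3 * n ^ 2 * L ^ 3 * l ^ 2) * gap f lb x := by
  have hvar := sum_sq_norm_deviation_gradient_le hL₀ hf hL hlb x
  set Q := ∑ i, ‖deviation (fun i => gradient (f i)) x i‖ ^ 2
  have hQ₀ : 0 ≤ Q := sum_nonneg fun _ _ => by positivity
  calc gap f lb (pass α ((fun i => gradient (f i)) ∘ σ) x (Fin.last n)) +
        n * α / 3 * ‖gradient (mean f) x‖ ^ 2
      ≤ gap f lb x + 2 * (n * α ^ 3 * L ^ 2 * (2 * l * √Q) ^ 2) :=
        gap_pass_add_le hn hα hαL hf hL hσ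
    _ = gap f lb x + 8 * (n * α ^ 3 * L ^ 2 * l ^ 2) * Q := by
        rw [mul_pow, Real.sq_sqrt hQ₀]; ring
    _ ≤ gap f lb x + 8 * (n * α ^ 3 * L ^ 2 * l ^ 2) * (2 * L * (n * gap f lb x)) := by gcongr
    _ = _ := by ring

end GapPass

section Run

/-- The start points `x 0 = x₀, x 1, x 2, …` of the passes of random reshuffling for the fields `g`,
where pass `t` has step size `α t` and uses the fields in the order `σ t`. -/
def run {E : Type*} [NormedAddCommGroup E] [NormedSpace ℝ E] {n : ℕ} (g : Fin n → E → E)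
    (α : ℕ → ℝ) (σ : ℕ → Equiv.Perm (Fin n)) (x₀ : E) : ℕ → E
  | 0 => x₀
  | t + 1 => pass (α t) (g ∘ σ t) (run g α σ x₀ t) (Fin.last n)

lemma run_congr {E : Type*} [NormedAddCommGroup E] [NormedSpace ℝ E] {n : ℕ} {g : Fin n → E → E}
    {α : ℕ → ℝ} {σ σ' : ℕ → Equiv.Perm (Fin n)} {x₀ : E} {t : ℕ} (h : ∀ s < t, σ s = σ' s) :
    run g α σ x₀ t = run g α σ' x₀ t := by
  induction t with
  | zero => rfl
  | succ t ih =>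
    rw [run, run, ih fun s hs => h s (hs.trans t.lt_succ_self), h t t.lt_succ_self]

lemma add_sum_range_le_exp_mul {a b q : ℕ → ℝ} {T : ℕ} (ha : ∀ t, 0 ≤ a t) (hb : ∀ t, 0 ≤ b t)
    (hq : ∀ t, 0 ≤ q t) (h : ∀ t < T, a (t + 1) + b t ≤ (1 + q t) * a t) :
    a T + ∑ t ∈ range T, b t ≤ Real.exp (∑ t ∈ range T, q t) * a 0 := by
  induction T with
  | zero => simp
  | succ T ih =>
    have hsum : 0 ≤ ∑ t ∈ range T, b t := sum_nonneg fun t _ => hb t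
    have hstep : (1 + q T) * a T + ∑ t ∈ range T, b t ≤
        (q T + 1) * (a T + ∑ t ∈ range T, b t) := by nlinarith [hq T]
    calc a (T + 1) + ∑ t ∈ range (T + 1), b t
        = a (T + 1) + b T + ∑ t ∈ range T, b t := by rw [sum_range_succ]; ring
      _ ≤ (q T + 1) * (a T + ∑ t ∈ range T, b t) :=
          (add_le_add_left (h T T.lt_succ_self) _).trans hstep
      _ ≤ Real.exp (q T) * (Real.exp (∑ t ∈ range T, q t) * a 0) := by
          gcongr
          · exact add_nonneg (ha T) hsum
          · exact Real.add_one_le_exp _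
          · exact ih fun t ht => h t (ht.trans T.lt_succ_self)
      _ = Real.exp (∑ t ∈ range (T + 1), q t) * a 0 := by
          rw [sum_range_succ_comm, Real.exp_add, mul_assoc]

theorem sum_sq_norm_gradient_run_le {E : Type*} [NormedAddCommGroup E] [InnerProductSpace ℝ E]
    [CompleteSpace E] {n : ℕ} {f : Fin n → E → ℝ} {lb : Fin n → ℝ} {L : ℝ≥0} {α : ℕ → ℝ} {l : ℝ}
    {σ : ℕ → Equiv.Perm (Fin n)} {x₀ : E} {T : ℕ} (hL₀ : 0 < L) (hn : 0 < n) (hα : ∀ t, 0 ≤ α t)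
    (hαL : ∀ t, 4 * (α t * (n * L)) ≤ 1)
    (hαT : ∑ t ∈ range T, 16 * α t ^ 3 * n ^ 2 * L ^ 3 * l ^ 2 ≤ 1)
    (hf : ∀ i, Differentiable ℝ (f i)) (hL : ∀ i, LipschitzWith L (gradient (f i)))
    (hlb : ∀ i x, lb i ≤ f i x)
    (hσ : ∀ t < T, IsBalanced (fun i => gradient (f i)) l
      (run (fun i => gradient (f i)) α σ x₀ t) (σ t)) :
    ∑ t ∈ range T,
        n * α t / 3 * ‖gradient (mean f) (run (fun i => gradient (f i)) α σ x₀ t)‖ ^ 2 ≤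
      3 * gap f lb x₀ := by
  set x := run (fun i => gradient (f i)) α σ x₀
  have hsum := add_sum_range_le_exp_mul (a := fun t => gap f lb (x t))
    (b := fun t => n * α t / 3 * ‖gradient (mean f) (x t)‖ ^ 2)
    (q := fun t => 16 * α t ^ 3 * n ^ 2 * L ^ 3 * l ^ 2) (T := T)
    (fun t => gap_nonneg hlb (x t)) (fun t => by have := hα t; positivity)
    (fun t => by have := hα t; positivity)
    (fun t ht => gap_pass_add_le_of_isBalanced hL₀ hn (hα t) (hαL t) hf hL hlb (hσ t ht))
  have hexp : Real.exp (∑ t ∈ range T, 16 * α t ^ 3 * n ^ 2 * L ^ 3 * l ^ 2) ≤ 3 :=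
    (Real.exp_le_exp.2 hαT).trans (Real.exp_one_lt_d9.le.trans (by norm_num))
  calc _ ≤ _ := le_add_of_nonneg_left (gap_nonneg hlb (x T))
    _ ≤ _ := hsum
    _ ≤ 3 * gap f lb x₀ := mul_le_mul_of_nonneg_right hexp (gap_nonneg hlb x₀)

end Run

section Probability

variable {Ω : Type*} [MeasurableSpace Ω] {μ : Measure Ω} [IsProbabilityMeasure μ]

lemma measure_prodMk_mem_le_of_indepFun {A B : Type*} [MeasurableSpace A] [MeasurableSpace B]
    {X : Ω → A} {Y : Ω → B} (hXY : IndepFun X Y μ) (hX : Measurable X) (hY : Measurable Y)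
    {S : Set (A × B)} (hS : MeasurableSet S) {p : ENNReal} (hp : ∀ a, μ {ω | (a, Y ω) ∈ S} ≤ p) :
    μ {ω | (X ω, Y ω) ∈ S} ≤ p := by
  have := Measure.isProbabilityMeasure_map (μ := μ) hX.aemeasurable
  calc μ {ω | (X ω, Y ω) ∈ S} = μ.map (fun ω => (X ω, Y ω)) S :=
        (Measure.map_apply (hX.prodMk hY) hS).symm
    _ = ((μ.map X).prod (μ.map Y)) S := by
        rw [(indepFun_iff_map_prod_eq_prod_map_map hX.aemeasurable hY.aemeasurable).1 hXY]
    _ = ∫⁻ a, μ {ω | (a, Y ω) ∈ S} ∂(μ.map X) := by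
        rw [Measure.prod_apply hS]
        exact lintegral_congr fun a => Measure.map_apply hY (measurable_prodMk_left hS)
    _ ≤ ∫⁻ _, p ∂(μ.map X) := lintegral_mono hp
    _ = p := by simp

variable {n : ℕ} {π : ℕ → Ω → Equiv.Perm (Fin n)}

lemma IsUniformReshuffling.measureReal_mem_eq_dens (hπ : IsUniformReshuffling μ π) (t : ℕ)
    (S : Finset (Equiv.Perm (Fin n))) : μ.real {ω | π t ω ∈ S} = S.dens := by
  calc μ.real {ω | π t ω ∈ S} = ∑ σ ∈ S, μ.real {ω | π t ω = σ} :=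
        (sum_measureReal_preimage_singleton S fun σ _ => hπ.measurable t σ).symm
    _ = S.dens := by
        simp only [hπ.uniform, sum_const, nsmul_eq_mul, dens, Fintype.card_perm, Fintype.card_fin]
        push_cast
        ring

/-- The past of pass `t` is independent of its permutation, so it may be held fixed. -/
theorem IsUniformReshuffling.measureReal_not_le (hπ : IsUniformReshuffling μ π) {t : ℕ}
    {P : (ℕ → Equiv.Perm (Fin n)) → Equiv.Perm (Fin n) → Prop} [∀ σ, DecidablePred (P σ)]
    (hP : ∀ σ σ', (∀ s < t, σ s = σ' s) → P σ = P σ') {p : ℝ}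
    (hp : ∀ σ, (({τ | ¬ P σ τ} : Finset (Equiv.Perm (Fin n))).dens : ℝ) ≤ p) :
    μ.real {ω | ¬ P (fun s => π s ω) (π t ω)} ≤ p := by
  let _ : MeasurableSpace (Equiv.Perm (Fin n)) := ⊤
  have _ : DiscreteMeasurableSpace (Equiv.Perm (Fin n)) := ⟨fun _ => trivial⟩
  have hmeas : ∀ s, Measurable (π s) := fun s => measurable_to_countable' (hπ.measurable s)
  let past : Ω → range t → Equiv.Perm (Fin n) := fun ω s => π s ω
  let extend : (range t → Equiv.Perm (Fin n)) → ℕ → Equiv.Perm (Fin n) :=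
    fun h s => if hs : s ∈ range t then h ⟨s, hs⟩ else 1
  have hind : IndepFun past (π t) μ :=
    (hπ.indep.indepFun_finset (range t) {t} (by simp) hmeas).comp measurable_id
      (measurable_pi_apply (⟨t, mem_singleton_self t⟩ : ({t} : Finset ℕ)))
  have hpast : ∀ ω, P (fun s => π s ω) = P (extend (past ω)) := fun ω =>
    hP _ _ fun s hs => by simp [extend, past, hs]
  have hp₀ : 0 ≤ p := (NNRat.cast_nonneg _).trans (hp 1)
  have hfixed : ∀ h, μ {ω | ¬ P (extend h) (π t ω)} ≤ ENNReal.ofReal p := fun h => by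
    rw [← ofReal_measureReal]
    refine ENNReal.ofReal_le_ofReal (le_of_eq_of_le ?_ (hp (extend h)))
    rw [← hπ.measureReal_mem_eq_dens t]
    simp
  have hpair := measure_prodMk_mem_le_of_indepFun (S := {x | ¬ P (extend x.1) x.2}) hind
    (measurable_pi_lambda _ fun s => hmeas s) (hmeas t) (Set.toFinite _).measurableSet hfixed
  simp only [hpast]
  exact ENNReal.toReal_le_of_le_ofReal hp₀ hpair

theorem IsUniformReshuffling.le_measureReal_forall_isBalanced (hπ : IsUniformReshuffling μ π)
    {E : Type*} [NormedAddCommGroup E] [InnerProductSpace ℝ E] (g : Fin n → E → E) (α : ℕ → ℝ)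
    (x₀ : E) (l : ℝ) (T : ℕ) :
    1 - T * (n * (8 * Real.exp (-l))) ≤
      μ.real {ω | ∀ t < T, IsBalanced g l (run g α (fun s => π s ω) x₀ t) (π t ω)} := by
  classical
  set good : ℕ → Set Ω := fun t => {ω | IsBalanced g l (run g α (fun s => π s ω) x₀ t) (π t ω)}
  have hbad : ∀ t, μ.real (good t)ᶜ ≤ n * (8 * Real.exp (-l)) := fun t =>
    hπ.measureReal_not_le (P := fun σ => IsBalanced g l (run g α σ x₀ t))
      (fun σ σ' h => by rw [run_congr h]) fun σ => dens_not_isBalanced_le g l _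
  have hgood : {ω | ∀ t < T, IsBalanced g l (run g α (fun s => π s ω) x₀ t) (π t ω)} =
      (⋃ t ∈ range T, (good t)ᶜ)ᶜ := by
    ext ω; simp [good]
  have hunion : μ.real (⋃ t ∈ range T, (good t)ᶜ) ≤ T * (n * (8 * Real.exp (-l))) :=
    calc μ.real (⋃ t ∈ range T, (good t)ᶜ) ≤ ∑ t ∈ range T, μ.real (good t)ᶜ :=
          measureReal_biUnion_finset_le _ _
      _ ≤ ∑ _t ∈ range T, n * (8 * Real.exp (-l)) := sum_le_sum fun t _ => hbad t
      _ = T * (n * (8 * Real.exp (-l))) := by simp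
  have hcover := measureReal_union_le (μ := μ) (⋃ t ∈ range T, (good t)ᶜ)
    (⋃ t ∈ range T, (good t)ᶜ)ᶜ
  rw [Set.union_compl_self, probReal_univ] at hcover
  rw [hgood]
  linarith

end Probability

section StepSize

/-- The bound on the average squared gradient norm of random reshuffling after `T` passes: the
first term dominates while the step size is `1 / (4 n L)`, the second one afterwards. -/
def rate (L : ℝ) (n T : ℕ) (δ F : ℝ) : ℝ :=
  max (45 * L * F / T)
    (35 * L ^ (2 / 3 : ℝ) * constA L ^ (1 / 3 : ℝ) * F * Real.log (8 * n * T / δ) ^ (2 / 3 : ℝ) /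
      ((n : ℝ) ^ (1 / 3 : ℝ) * (T : ℝ) ^ (2 / 3 : ℝ)))

lemma rpow_one_third_mul_rpow_two_thirds {y : ℝ} (hy : 0 < y) :
    y ^ (1 / 3 : ℝ) * y ^ (2 / 3 : ℝ) = y := by
  rw [← Real.rpow_add hy]; norm_num

lemma sq_rpow_one_third {y : ℝ} (hy : 0 ≤ y) : (y ^ 2) ^ (1 / 3 : ℝ) = y ^ (2 / 3 : ℝ) := by
  rw [← Real.rpow_natCast, ← Real.rpow_mul hy]; norm_num

variable {L δ : ℝ} {n T : ℕ}

lemma log_eight_mul_div_pos (hn : 0 < n) (hT : 0 < T) (hδ : 0 < δ) (hδ₁ : δ < 1) :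
    0 < Real.log (8 * n * T / δ) := by
  have hnT : (1 : ℝ) ≤ n * T := mod_cast Nat.mul_pos hn hT
  refine Real.log_pos ((one_lt_div hδ).2 ?_)
  linarith

lemma constC₁_mul_pos (hL : 0 < L) (hn : 0 < n) (hT : 0 < T) (hδ : 0 < δ) (hδ₁ : δ < 1) :
    0 < constC₁ L n T δ * (n : ℝ) ^ 2 * T := by
  have := log_eight_mul_div_pos hn hT hδ hδ₁
  rw [constC₁, constA]
  positivity

lemma stepSize_pos (hL : 0 < L) (hn : 0 < n) (hT : 0 < T) (hδ : 0 < δ) (hδ₁ : δ < 1) :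
    0 < stepSize L n T δ := by
  have := constC₁_mul_pos hL hn hT hδ hδ₁
  exact lt_min (by positivity) (by positivity)

lemma four_mul_stepSize_mul_le_one (hL : 0 < L) (hn : 0 < n) :
    4 * (stepSize L n T δ * (n * L)) ≤ 1 := by
  have hmin : stepSize L n T δ ≤ 1 / (4 * n * L) := min_le_left _ _
  rw [le_div_iff₀ (by positivity)] at hmin
  linarith

lemma stepSize_pow_three_mul_le_one (hL : 0 < L) (hn : 0 < n) (hT : 0 < T) (hδ : 0 < δ)
    (hδ₁ : δ < 1) : stepSize L n T δ ^ 3 * (constC₁ L n T δ * (n : ℝ) ^ 2 * T) ≤ 1 := by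
  have hC := constC₁_mul_pos hL hn hT hδ hδ₁
  have hcube : ((constC₁ L n T δ * (n : ℝ) ^ 2 * T) ^ (1 / 3 : ℝ)) ^ 3 =
      constC₁ L n T δ * (n : ℝ) ^ 2 * T := by
    simpa using Real.rpow_inv_natCast_pow hC.le three_ne_zero
  have hmin := pow_le_pow_left₀ (stepSize_pos hL hn hT hδ hδ₁).le (min_le_right _ _) 3
  rwa [div_pow, hcube, one_pow, le_div_iff₀ hC] at hmin

lemma inv_stepSize (hL : 0 < L) (hn : 0 < n) (hT : 0 < T) (hδ : 0 < δ) (hδ₁ : δ < 1) :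
    (stepSize L n T δ)⁻¹ =
      max (4 * n * L) ((constC₁ L n T δ * (n : ℝ) ^ 2 * T) ^ (1 / 3 : ℝ)) := by
  have := constC₁_mul_pos hL hn hT hδ hδ₁
  rw [stepSize, one_div, one_div, inv_antitoneOn_Ioi.map_min, inv_inv, inv_inv] <;>
    exact Set.mem_Ioi.2 (by positivity)

lemma rpow_constC₁_mul_le (hL : 0 < L) (hn : 0 < n) (hT : 0 < T) (hδ : 0 < δ) (hδ₁ : δ < 1) :
    (constC₁ L n T δ * (n : ℝ) ^ 2 * T) ^ (1 / 3 : ℝ) ≤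
      4 * L ^ (2 / 3 : ℝ) * constA L ^ (1 / 3 : ℝ) * Real.log (8 * n * T / δ) ^ (2 / 3 : ℝ) *
        (n : ℝ) ^ (2 / 3 : ℝ) * (T : ℝ) ^ (1 / 3 : ℝ) := by
  have hlog := log_eight_mul_div_pos hn hT hδ hδ₁
  have hA : 0 < constA L := by rw [constA]; positivity
  have h32 : (32 : ℝ) ^ (1 / 3 : ℝ) ≤ 4 := by
    rw [one_div, Real.rpow_inv_le_iff_of_pos] <;> norm_num
  rw [constC₁, Real.mul_rpow (by positivity) (by positivity),
    Real.mul_rpow (by positivity) (by positivity), Real.mul_rpow (by positivity) (by positivity),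
    Real.mul_rpow (by positivity) (by positivity), Real.mul_rpow (by positivity) (by positivity),
    sq_rpow_one_third hL.le, sq_rpow_one_third hlog.le, sq_rpow_one_third n.cast_nonneg]
  gcongr

lemma div_stepSize_le_rate {F : ℝ} (hL : 0 < L) (hn : 0 < n) (hT : 0 < T) (hδ : 0 < δ)
    (hδ₁ : δ < 1) (hF : 0 ≤ F) : 3 * F / (n * stepSize L n T δ * T) ≤ rate L n T δ F := by
  have hlog := log_eight_mul_div_pos hn hT hδ hδ₁
  have hA : 0 < constA L := by rw [constA]; positivity
  have := constC₁_mul_pos hL hn hT hδ hδ₁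
  set l := Real.log (8 * n * T / δ)
  have hfactor : 3 * F / (n * stepSize L n T δ * T) =
      max (3 * F / (n * T) * (4 * n * L))
        (3 * F / (n * T) * (constC₁ L n T δ * (n : ℝ) ^ 2 * T) ^ (1 / 3 : ℝ)) := by
    rw [← mul_max_of_nonneg _ _ (by positivity), ← inv_stepSize hL hn hT hδ hδ₁]
    have := stepSize_pos hL hn hT hδ hδ₁
    field_simp
  rw [hfactor, rate]
  refine max_le_max ?_ ?_
  · calc 3 * F / (n * T) * (4 * n * L) = 12 * L * F / T := by field_simp; ring
      _ ≤ 45 * L * F / T := by gcongr; norm_num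
  · calc 3 * F / (n * T) * (constC₁ L n T δ * (n : ℝ) ^ 2 * T) ^ (1 / 3 : ℝ)
        ≤ 3 * F / (n * T) * (4 * L ^ (2 / 3 : ℝ) * constA L ^ (1 / 3 : ℝ) * l ^ (2 / 3 : ℝ) *
            (n : ℝ) ^ (2 / 3 : ℝ) * (T : ℝ) ^ (1 / 3 : ℝ)) := by
          gcongr; exact rpow_constC₁_mul_le hL hn hT hδ hδ₁
      _ = 12 * L ^ (2 / 3 : ℝ) * constA L ^ (1 / 3 : ℝ) * F * l ^ (2 / 3 : ℝ) /
            ((n : ℝ) ^ (1 / 3 : ℝ) * (T : ℝ) ^ (2 / 3 : ℝ)) := by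
          nth_rw 1 [← rpow_one_third_mul_rpow_two_thirds (y := n) (by positivity),
            ← rpow_one_third_mul_rpow_two_thirds (y := T) (by positivity)]
          field_simp
          ring
      _ ≤ 35 * L ^ (2 / 3 : ℝ) * constA L ^ (1 / 3 : ℝ) * F * l ^ (2 / 3 : ℝ) /
            ((n : ℝ) ^ (1 / 3 : ℝ) * (T : ℝ) ^ (2 / 3 : ℝ)) := by
          gcongr; norm_num

end StepSize

section HighProbability

/-- The average of `‖∇f‖²` over the start points of the first `T` passes, where `∇f` is the gradient
of the mean of the components `f i` and the passes take steps along the component gradients. -/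
def avgSqNormGradient {E : Type*} [NormedAddCommGroup E] [InnerProductSpace ℝ E] [CompleteSpace E]
    {n : ℕ} (f : Fin n → E → ℝ) (α : ℕ → ℝ) (σ : ℕ → Equiv.Perm (Fin n)) (x₀ : E) (T : ℕ) : ℝ :=
  (T : ℝ)⁻¹ * ∑ t ∈ range T, ‖gradient (mean f) (run (fun i => gradient (f i)) α σ x₀ t)‖ ^ 2

theorem avgSqNormGradient_le_rate {E : Type*} [NormedAddCommGroup E]
    [InnerProductSpace ℝ E] [CompleteSpace E] {n : ℕ} {f : Fin n → E → ℝ} {lb : Fin n → ℝ}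
    {L : ℝ≥0} {x₀ : E} {T : ℕ} {δ : ℝ} {σ : ℕ → Equiv.Perm (Fin n)} (hL₀ : 0 < L) (hn : 0 < n)
    (hT : 0 < T) (hδ : 0 < δ) (hδ₁ : δ < 1) (hf : ∀ i, Differentiable ℝ (f i))
    (hL : ∀ i, LipschitzWith L (gradient (f i))) (hlb : ∀ i x, lb i ≤ f i x)
    (hσ : ∀ t < T, IsBalanced (fun i => gradient (f i)) (Real.log (8 * n * T / δ))
      (run (fun i => gradient (f i)) (fun _ => stepSize L n T δ) σ x₀ t) (σ t)) :
    avgSqNormGradient f (fun _ => stepSize L n T δ) σ x₀ T ≤ rate L n T δ (3 * gap f lb x₀) := by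
  have hL₀' : (0 : ℝ) < L := hL₀
  have hα := stepSize_pos hL₀' hn hT hδ hδ₁
  have hαL := four_mul_stepSize_mul_le_one (T := T) (δ := δ) hL₀' hn
  have hαT := stepSize_pow_three_mul_le_one hL₀' hn hT hδ hδ₁
  have hF : 0 ≤ 3 * gap f lb x₀ := mul_nonneg zero_le_three (gap_nonneg hlb x₀)
  refine le_trans ?_ (div_stepSize_le_rate hL₀' hn hT hδ hδ₁ hF)
  rw [constC₁, constA] at hαT
  set α := stepSize L n T δ
  set l := Real.log (8 * n * T / δ)
  have hgrowth : ∑ _t ∈ range T, 16 * α ^ 3 * n ^ 2 * L ^ 3 * l ^ 2 ≤ (1 : ℝ) := by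
    have : 0 ≤ α ^ 3 * (32 * (L : ℝ) ^ 2 * (2 * L) * l ^ 2 * n ^ 2 * T) := by positivity
    rw [sum_const, card_range, nsmul_eq_mul]
    linarith
  have hsum := sum_sq_norm_gradient_run_le hL₀ hn (fun _ => hα.le) (fun _ => hαL) hgrowth hf hL
    hlb hσ
  rw [← mul_sum] at hsum
  rw [avgSqNormGradient, le_div_iff₀ (by positivity)]
  field_simp
  linarith

theorem IsUniformReshuffling.le_measureReal_avgSqNormGradient_le_rate
    {Ω : Type*} [MeasurableSpace Ω] {μ : Measure Ω} [IsProbabilityMeasure μ] {n : ℕ}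
    {π : ℕ → Ω → Equiv.Perm (Fin n)} (hπ : IsUniformReshuffling μ π) {E : Type*}
    [NormedAddCommGroup E] [InnerProductSpace ℝ E] [CompleteSpace E] {f : Fin n → E → ℝ}
    {lb : Fin n → ℝ} {L : ℝ≥0} {T : ℕ} {δ : ℝ} (hL₀ : 0 < L) (hn : 0 < n) (hT : 0 < T)
    (hδ : 0 < δ) (hδ₁ : δ < 1) (hf : ∀ i, Differentiable ℝ (f i))
    (hL : ∀ i, LipschitzWith L (gradient (f i))) (hlb : ∀ i x, lb i ≤ f i x) (x₀ : E) :
    1 - δ ≤ μ.real {ω | avgSqNormGradient f (fun _ => stepSize L n T δ) (fun s => π s ω) x₀ T ≤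
      rate L n T δ (3 * gap f lb x₀)} := by
  have hfail : T * (n * (8 * Real.exp (-Real.log (8 * n * T / δ)))) = δ := by
    rw [Real.exp_neg, Real.exp_log (by positivity)]
    field_simp
  have hgood := hπ.le_measureReal_forall_isBalanced (fun i => gradient (f i))
    (fun _ => stepSize L n T δ) x₀ (Real.log (8 * n * T / δ)) T
  rw [hfail] at hgood
  exact hgood.trans (measureReal_mono fun ω hω =>
    avgSqNormGradient_le_rate hL₀ hn hT hδ hδ₁ hf hL hlb hω)

end HighProbability

section Complexity

variable {L F δ ε : ℝ} {n T : ℕ}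

lemma rate_le_rate {F' : ℝ} (hL : 0 ≤ L) (hn : 0 < n) (hT : 0 < T) (hδ : 0 < δ) (hδ₁ : δ < 1)
    (hF : F ≤ F') : rate L n T δ F ≤ rate L n T δ F' := by
  have hlog := log_eight_mul_div_pos hn hT hδ hδ₁
  have hA : 0 ≤ constA L := by rw [constA]; positivity
  unfold rate
  gcongr

lemma rate_le_sq (hL : 0 < L) (hF : 0 < F) (hn : 0 < n) (hT : 0 < T) (hδ : 0 < δ) (hδ₁ : δ < 1)
    (hε : 0 < ε) (hlin : 45 * L * F ≤ ε ^ 2 * T)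
    (hlog : (70 * L * F) ^ (3 / 2 : ℝ) * Real.log (8 * n * T / δ) ≤ ε ^ 3 * √n * T) :
    rate L n T δ F ≤ ε ^ 2 := by
  have hlog₀ := log_eight_mul_div_pos hn hT hδ hδ₁
  set l := Real.log (8 * n * T / δ)
  have hA : L ^ (2 / 3 : ℝ) * constA L ^ (1 / 3 : ℝ) ≤ 2 * L :=
    calc L ^ (2 / 3 : ℝ) * (2 * L) ^ (1 / 3 : ℝ)
        ≤ (2 * L) ^ (2 / 3 : ℝ) * (2 * L) ^ (1 / 3 : ℝ) := by gcongr; linarith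
      _ = 2 * L := by rw [mul_comm, rpow_one_third_mul_rpow_two_thirds (by positivity)]
  have hpow : 70 * L * F * l ^ (2 / 3 : ℝ) ≤ ε ^ 2 * (n ^ (1 / 3 : ℝ) * T ^ (2 / 3 : ℝ)) := by
    have hF_pow : ((70 * L * F) ^ (3 / 2 : ℝ)) ^ (2 / 3 : ℝ) = 70 * L * F := by
      rw [← Real.rpow_mul (by positivity)]; norm_num
    have hε_pow : (ε ^ 3) ^ (2 / 3 : ℝ) = ε ^ 2 := by
      rw [← Real.rpow_natCast, ← Real.rpow_mul hε.le, ← Real.rpow_natCast]; norm_num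
    have hn_pow : √n ^ (2 / 3 : ℝ) = n ^ (1 / 3 : ℝ) := by
      rw [Real.sqrt_eq_rpow, ← Real.rpow_mul n.cast_nonneg]; norm_num
    have := Real.rpow_le_rpow (by positivity) hlog (show (0 : ℝ) ≤ 2 / 3 by norm_num)
    rwa [Real.mul_rpow (by positivity) hlog₀.le, hF_pow, Real.mul_rpow (by positivity)
      T.cast_nonneg, Real.mul_rpow (by positivity) (by positivity), hε_pow, hn_pow,
      mul_assoc (ε ^ 2)] at this
  refine max_le ((div_le_iff₀ (by positivity)).2 hlin) ((div_le_iff₀ (by positivity)).2 ?_)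
  calc 35 * L ^ (2 / 3 : ℝ) * constA L ^ (1 / 3 : ℝ) * F * l ^ (2 / 3 : ℝ)
      = 35 * (L ^ (2 / 3 : ℝ) * constA L ^ (1 / 3 : ℝ)) * F * l ^ (2 / 3 : ℝ) := by ring
    _ ≤ 35 * (2 * L) * F * l ^ (2 / 3 : ℝ) := by gcongr
    _ = 70 * L * F * l ^ (2 / 3 : ℝ) := by ring
    _ ≤ _ := hpow

/-- Since `log (8 y) ≤ 2 √(8 y)`, the logarithm costs at most `y / 2` once `128 c ^ 2 ≤ y`. -/
lemma mul_log_add_le {c y W : ℝ} (hc : 0 < c) (hW : 1 ≤ W)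
    (hy : (128 * c ^ 2 + 4 * c) * W ≤ y) : c * (Real.log (8 * y) + 2 * W) ≤ y := by
  have hy_sq : 128 * c ^ 2 ≤ y := by nlinarith [sq_nonneg c]
  have hy_lin : 4 * c * W ≤ y := by nlinarith [sq_nonneg c]
  have hy₀ : 0 < y := lt_of_lt_of_le (by positivity) hy_sq
  have hlog : Real.log (8 * y) ≤ 2 * √(8 * y) := by
    have := Real.log_le_self (Real.sqrt_nonneg (8 * y))
    rw [Real.log_sqrt (by positivity)] at this
    linarith
  have hsqrt : 32 * c ≤ √(8 * y) := Real.le_sqrt_of_sq_le (by linarith)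
  have hlog_cost : c * Real.log (8 * y) ≤ y / 2 :=
    calc c * Real.log (8 * y) ≤ 32 * c * √(8 * y) / 16 := by
          linarith [mul_le_mul_of_nonneg_left hlog hc.le]
      _ ≤ √(8 * y) * √(8 * y) / 16 := by gcongr
      _ = y / 2 := by rw [Real.mul_self_sqrt (by positivity)]; ring
  linarith

/-- The number of gradient evaluations needed to make the average squared gradient norm at most
`ε ^ 2`, up to constants and logarithms. -/
def evalScale (n : ℕ) (ε : ℝ) : ℝ := max (√n * ε⁻¹ ^ 3) (n * ε⁻¹ ^ 2)

/-- The logarithmic factor by which the number of gradient evaluations exceeds `evalScale`. -/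
def logFactor (n : ℕ) (ε δ : ℝ) : ℝ := 1 + Real.log (√n * ε⁻¹ ^ 3 / δ)

/-- The factor by which the number of gradient evaluations exceeds `evalScale` and `logFactor`. Its
first two terms control the logarithmic branch of `rate`, the third one the linear branch. -/
def evalConst (L F : ℝ) : ℝ :=
  128 * ((70 * L * F) ^ (3 / 2 : ℝ)) ^ 2 + 4 * (70 * L * F) ^ (3 / 2 : ℝ) + 45 * L * F

lemma evalConst_pos (hL : 0 < L) (hF : 0 < F) : 0 < evalConst L F := by
  rw [evalConst]; positivity

lemma one_le_sqrt_mul_inv_pow_div (hn : 0 < n) (hε : 0 < ε) (hε₁ : ε ≤ 1) (hδ : 0 < δ)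
    (hδ₁ : δ ≤ 1) : 1 ≤ √n * ε⁻¹ ^ 3 / δ := by
  rw [one_le_div hδ]
  exact hδ₁.trans (one_le_mul_of_one_le_of_one_le (Real.one_le_sqrt.2 (mod_cast hn))
    (one_le_pow₀ ((one_le_inv₀ hε).2 hε₁)))

lemma one_le_logFactor (hn : 0 < n) (hε : 0 < ε) (hε₁ : ε ≤ 1) (hδ : 0 < δ) (hδ₁ : δ ≤ 1) :
    1 ≤ logFactor n ε δ :=
  le_add_of_nonneg_right (Real.log_nonneg (one_le_sqrt_mul_inv_pow_div hn hε hε₁ hδ hδ₁))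

lemma natCast_le_evalScale (hε : 0 < ε) (hε₁ : ε ≤ 1) : n ≤ evalScale n ε :=
  (le_mul_of_one_le_right n.cast_nonneg (one_le_pow₀ ((one_le_inv₀ hε).2 hε₁))).trans
    (le_max_right _ _)

lemma evalScale_pos (hn : 0 < n) (hε : 0 < ε) : 0 < evalScale n ε :=
  lt_max_of_lt_left (by positivity)

lemma log_evalScale_div_le (hn : 0 < n) (hε : 0 < ε) (hε₁ : ε ≤ 1) (hδ : 0 < δ) (hδ₁ : δ ≤ 1) :
    Real.log (evalScale n ε / δ) ≤ 2 * logFactor n ε δ := by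
  have harg := one_le_sqrt_mul_inv_pow_div hn hε hε₁ hδ hδ₁
  have hpos := evalScale_pos hn hε
  have hsq : evalScale n ε / δ ≤ (√n * ε⁻¹ ^ 3 / δ) ^ 2 := by
    rw [evalScale, ← max_div_div_right hδ.le]
    refine max_le (le_self_pow₀ harg two_ne_zero) ?_
    rw [div_pow, mul_pow, Real.sq_sqrt n.cast_nonneg, ← pow_mul]
    gcongr
    · exact (one_le_inv₀ hε).2 hε₁
    · norm_num
    · exact pow_le_of_le_one hδ.le hδ₁ two_ne_zero
  calc Real.log (evalScale n ε / δ) ≤ Real.log ((√n * ε⁻¹ ^ 3 / δ) ^ 2) := by gcongr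
    _ = 2 * Real.log (√n * ε⁻¹ ^ 3 / δ) := by rw [Real.log_pow]; norm_cast
    _ ≤ 2 * logFactor n ε δ := by rw [logFactor]; linarith

lemma mul_log_le_of_evalScale_le {c : ℝ} (hc : 0 < c) (hn : 0 < n) (hT : 0 < T) (hε : 0 < ε)
    (hε₁ : ε ≤ 1) (hδ : 0 < δ) (hδ₁ : δ ≤ 1)
    (h : (128 * c ^ 2 + 4 * c) * evalScale n ε * logFactor n ε δ ≤ n * T) :
    c * Real.log (8 * n * T / δ) ≤ ε ^ 3 * √n * T := by
  have hN := evalScale_pos hn hε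
  have hW := one_le_logFactor hn hε hε₁ hδ hδ₁
  have hlog_le := log_evalScale_div_le hn hε hε₁ hδ hδ₁
  have hN_le : √n * ε⁻¹ ^ 3 ≤ evalScale n ε := le_max_left _ _
  set N := evalScale n ε
  set W := logFactor n ε δ
  have hc_le : (128 * c ^ 2 + 4 * c) * W ≤ n * T / N := by
    rw [le_div_iff₀ hN]
    linarith
  have hlog : Real.log (8 * n * T / δ) = Real.log (8 * (n * T / N)) + Real.log (N / δ) := by
    rw [← Real.log_mul (by positivity) (by positivity)]
    field_simp
  calc c * Real.log (8 * n * T / δ) ≤ c * (Real.log (8 * (n * T / N)) + 2 * W) := by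
        rw [hlog]
        gcongr
    _ ≤ n * T / N := mul_log_add_le hc hW hc_le
    _ ≤ n * T / (√n * ε⁻¹ ^ 3) := by gcongr
    _ = ε ^ 3 * √n * T := by
        field_simp
        rw [Real.sq_sqrt n.cast_nonneg]

theorem rate_le_sq_of_evalScale_le (hL : 0 < L) (hF : 0 < F) (hn : 0 < n) (hT : 0 < T)
    (hε : 0 < ε) (hε₁ : ε ≤ 1) (hδ : 0 < δ) (hδ₁ : δ < 1)
    (h : evalConst L F * evalScale n ε * logFactor n ε δ ≤ n * T) : rate L n T δ F ≤ ε ^ 2 := by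
  have hN := evalScale_pos hn hε
  have hW := one_le_logFactor hn hε hε₁ hδ hδ₁.le
  refine rate_le_sq hL hF hn hT hδ hδ₁ hε ?_
    (mul_log_le_of_evalScale_le (by positivity) hn hT hε hε₁ hδ hδ₁.le (le_trans ?_ h))
  · have hlin : 45 * L * F * (n * ε⁻¹ ^ 2) ≤ n * T :=
      calc 45 * L * F * (n * ε⁻¹ ^ 2) ≤ 45 * L * F * evalScale n ε := by
            gcongr; exact le_max_right _ _
        _ ≤ evalConst L F * evalScale n ε := by
            gcongr
            exact le_add_of_nonneg_left (by positivity)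
        _ ≤ evalConst L F * evalScale n ε * logFactor n ε δ :=
            le_mul_of_one_le_right (mul_pos (evalConst_pos hL hF) hN).le hW
        _ ≤ n * T := h
    field_simp at hlin
    linarith
  · exact mul_le_mul_of_nonneg_right (mul_le_mul_of_nonneg_right
      (le_add_of_nonneg_right (by positivity)) hN.le) (zero_le_one.trans hW)

theorem exists_forall_rate_le_sq (hL : 0 < L) (hF : 0 < F) (hn : 0 < n) (hε : 0 < ε) (hε₁ : ε ≤ 1)
    (hδ : 0 < δ) (hδ₁ : δ < 1) :
    ∃ T₀ : ℕ, 0 < T₀ ∧ n * T₀ ≤ (evalConst L F + 1) * evalScale n ε * logFactor n ε δ ∧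
      ∀ T ≥ T₀, rate L n T δ F ≤ ε ^ 2 := by
  have hn' : (0 : ℝ) < n := mod_cast hn
  have hK := evalConst_pos hL hF
  have hN := evalScale_pos hn hε
  have hW := one_le_logFactor hn hε hε₁ hδ hδ₁.le
  set X := evalConst L F * evalScale n ε * logFactor n ε δ / n with hX_def
  have hX : 0 < X := by positivity
  refine ⟨⌈X⌉₊, Nat.ceil_pos.2 hX, ?_, fun T hT => ?_⟩
  · have hnW : (n : ℝ) ≤ evalScale n ε * logFactor n ε δ :=
      (natCast_le_evalScale hε hε₁).trans (le_mul_of_one_le_right hN.le hW)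
    calc (n : ℝ) * ⌈X⌉₊ ≤ n * (X + 1) := by gcongr; exact (Nat.ceil_lt_add_one hX.le).le
      _ = evalConst L F * evalScale n ε * logFactor n ε δ + n := by rw [hX_def]; field_simp
      _ ≤ (evalConst L F + 1) * evalScale n ε * logFactor n ε δ := by linarith
  · refine rate_le_sq_of_evalScale_le hL hF hn ((Nat.ceil_pos.2 hX).trans_le hT) hε hε₁ hδ hδ₁ ?_
    rw [← div_le_iff₀' hn']
    exact Nat.ceil_le.1 hT

end Complexity

section EuclideanSpace

variable {d n : ℕ} (f : Fin n → EuclideanSpace ℝ (Fin d) → ℝ)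

lemma objective_eq_mean : objective f = mean f := by
  ext x
  rw [objective, mean, one_div, smul_eq_mul]

lemma innerIterate_eq_pass (α : ℝ) (σ : Equiv.Perm (Fin n)) (x : EuclideanSpace ℝ (Fin d))
    (k : Fin (n + 1)) :
    innerIterate f α σ x k = pass α ((fun i => gradient (f i)) ∘ σ) x k := by
  induction k using Fin.induction with
  | zero => rfl
  | succ k ih =>
    rw [Fin.val_castSucc] at ih
    rw [Fin.val_succ, innerIterate, dif_pos k.is_lt, ih, pass_succ]
    rfl

lemma iterate_eq_run (α : ℕ → ℝ) (σ : ℕ → Equiv.Perm (Fin n)) (x₀ : EuclideanSpace ℝ (Fin d))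
    (t : ℕ) : iterate f α σ x₀ t = run (fun i => gradient (f i)) α σ x₀ t := by
  induction t with
  | zero => rfl
  | succ t ih =>
    rw [iterate, ih, run, ← innerIterate_eq_pass, Fin.val_last]

lemma avgSqGrad_eq_avgSqNormGradient (L : ℝ) (x₀ : EuclideanSpace ℝ (Fin d)) (T : ℕ) (δ : ℝ)
    (σ : ℕ → Equiv.Perm (Fin n)) :
    avgSqGrad L f x₀ T δ σ = avgSqNormGradient f (fun _ => stepSize L n T δ) σ x₀ T := by
  simp only [avgSqGrad, avgSqNormGradient, one_div, objective_eq_mean, iterate_eq_run]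

lemma constF_eq_three_mul_gap {L : ℝ} (hL : L ≠ 0) (hn : 0 < n) (lb : Fin n → ℝ) (fbar : ℝ)
    (x₀ : EuclideanSpace ℝ (Fin d)) : constF L f lb fbar x₀ = 3 * gap f lb x₀ := by
  rw [constF, constB, constA, gap, objective_eq_mean, sum_sub_distrib, sum_const, card_univ,
    Fintype.card_fin, nsmul_eq_mul]
  field_simp
  ring

end EuclideanSpace

end RandomReshuffling

end

open RandomReshuffling in
theorem mainTheorem1_general (L : ℝ≥0) (hL : 0 < L) :
    (∀ (E : Type*) [NormedAddCommGroup E] [InnerProductSpace ℝ E] [CompleteSpace E] (n T : ℕ)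
        (f : Fin n → E → ℝ) (lb : Fin n → ℝ) (x₀ : E) (δ : ℝ)
        (Ω : Type*) [MeasurableSpace Ω] (μ : Measure Ω) [IsProbabilityMeasure μ]
        (π : ℕ → Ω → Equiv.Perm (Fin n)),
        0 < n → 0 < T → 0 < δ → δ < 1 →
        (∀ i, Differentiable ℝ (f i)) → (∀ i x, lb i ≤ f i x) →
        (∀ i, LipschitzWith L (gradient (f i))) →
        IsUniformReshuffling μ π →
        1 - δ ≤ μ.real {ω |
          avgSqNormGradient f (fun _ => stepSize L n T δ) (fun t => π t ω) x₀ T ≤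
            rate L n T δ (3 * gap f lb x₀)}) ∧
    (∀ Φ : ℝ, ∃ K : ℝ, 0 < K ∧
      ∀ (n : ℕ) (ε δ : ℝ), 0 < n → 0 < ε → ε ≤ 1 → 0 < δ → δ < 1 →
      ∃ T₀ : ℕ, 0 < T₀ ∧ n * T₀ ≤ K * evalScale n ε * logFactor n ε δ ∧
        ∀ T ≥ T₀, ∀ (E : Type*) [NormedAddCommGroup E] [InnerProductSpace ℝ E] [CompleteSpace E]
          (f : Fin n → E → ℝ) (lb : Fin n → ℝ) (x₀ : E)
          (Ω : Type*) [MeasurableSpace Ω] (μ : Measure Ω) [IsProbabilityMeasure μ]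
          (π : ℕ → Ω → Equiv.Perm (Fin n)),
          (∀ i, Differentiable ℝ (f i)) → (∀ i x, lb i ≤ f i x) →
          (∀ i, LipschitzWith L (gradient (f i))) →
          3 * gap f lb x₀ ≤ Φ →
          IsUniformReshuffling μ π →
          1 - δ ≤ μ.real {ω |
            avgSqNormGradient f (fun _ => stepSize L n T δ) (fun t => π t ω) x₀ T ≤ ε ^ 2}) := by
  refine ⟨fun E _ _ _ n T f lb x₀ δ Ω _ μ _ π hn hT hδ hδ₁ hf hlb hlip hπ =>
    hπ.le_measureReal_avgSqNormGradient_le_rate hL hn hT hδ hδ₁ hf hlip hlb x₀, fun Φ => ?_⟩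
  have hΦ : 0 < max Φ 1 := lt_max_of_lt_right one_pos
  refine ⟨evalConst L (max Φ 1) + 1, add_pos (evalConst_pos hL hΦ) one_pos,
    fun n ε δ hn hε hε₁ hδ hδ₁ => ?_⟩
  obtain ⟨T₀, hT₀, hcost, hrate⟩ := exists_forall_rate_le_sq (L := L) hL hΦ hn hε hε₁ hδ hδ₁
  refine ⟨T₀, hT₀, hcost, fun T hT E _ _ _ f lb x₀ Ω _ μ _ π hf hlb hlip hgap hπ => ?_⟩
  have hTpos : 0 < T := hT₀.trans_le hT
  have hsmall : rate L n T δ (3 * gap f lb x₀) ≤ ε ^ 2 :=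
    (rate_le_rate L.coe_nonneg hn hTpos hδ hδ₁ (hgap.trans (le_max_left _ _))).trans (hrate T hT)
  exact (hπ.le_measureReal_avgSqNormGradient_le_rate hL hn hTpos hδ hδ₁ hf hlip hlb x₀).trans
    (measureReal_mono fun ω hω => le_trans hω hsmall)

theorem mainTheorem1 (L : ℝ≥0) (hL : 0 < L) :
    (∀ (d n T : ℕ) (f : Fin n → EuclideanSpace ℝ (Fin d) → ℝ) (lb : Fin n → ℝ) (fbar : ℝ)
        (x₀ : EuclideanSpace ℝ (Fin d)) (δ : ℝ)
        (Ω : Type*) [MeasurableSpace Ω] (μ : Measure Ω) [IsProbabilityMeasure μ]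
        (π : ℕ → Ω → Equiv.Perm (Fin n)),
        0 < n → 0 < T → 0 < δ → δ < 1 →
        RandomReshuffling.SmoothBoundedBelow f lb L →
        (∀ x, fbar ≤ RandomReshuffling.objective f x) →
        RandomReshuffling.IsUniformReshuffling μ π →
        1 - δ ≤ μ.real {ω |
          RandomReshuffling.avgSqGrad L f x₀ T δ (fun t => π t ω) ≤
            max (45 * L * RandomReshuffling.constF L f lb fbar x₀ / T)
              (35 * (L : ℝ) ^ (2 / 3 : ℝ) * RandomReshuffling.constA L ^ (1 / 3 : ℝ)
                  * RandomReshuffling.constF L f lb fbar x₀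
                  * Real.log (8 * n * T / δ) ^ (2 / 3 : ℝ)
                / ((n : ℝ) ^ (1 / 3 : ℝ) * (T : ℝ) ^ (2 / 3 : ℝ)))}) ∧
    (∀ Φ : ℝ, ∃ K : ℝ, 0 < K ∧
      ∀ (n : ℕ) (ε δ : ℝ), 0 < n → 0 < ε → ε ≤ 1 → 0 < δ → δ < 1 →
      ∃ T₀ : ℕ, 0 < T₀ ∧
        (n : ℝ) * T₀ ≤ K * max (Real.sqrt n * ε⁻¹ ^ 3) (n * ε⁻¹ ^ 2)
          * (1 + Real.log (Real.sqrt n * ε⁻¹ ^ 3 / δ)) ∧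
        ∀ (T : ℕ), T₀ ≤ T →
        ∀ (d : ℕ) (f : Fin n → EuclideanSpace ℝ (Fin d) → ℝ) (lb : Fin n → ℝ) (fbar : ℝ)
          (x₀ : EuclideanSpace ℝ (Fin d))
          (Ω : Type*) [MeasurableSpace Ω] (μ : Measure Ω) [IsProbabilityMeasure μ]
          (π : ℕ → Ω → Equiv.Perm (Fin n)),
          RandomReshuffling.SmoothBoundedBelow f lb L →
          (∀ x, fbar ≤ RandomReshuffling.objective f x) →
          RandomReshuffling.constF L f lb fbar x₀ ≤ Φ →
          RandomReshuffling.IsUniformReshuffling μ π →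
          1 - δ ≤ μ.real {ω |
            RandomReshuffling.avgSqGrad L f x₀ T δ (fun t => π t ω) ≤ ε ^ 2}) := by
  refine ⟨fun d n T f lb fbar x₀ δ Ω _ μ _ π hn hT hδ hδ₁ hf _ hπ => ?_, fun Φ => ?_⟩
  · simp only [RandomReshuffling.constF_eq_three_mul_gap f (NNReal.coe_ne_zero.2 hL.ne') hn,
      RandomReshuffling.avgSqGrad_eq_avgSqNormGradient]
    exact (mainTheorem1_general.{0, _, 0, 0} L hL).1 _ n T f lb x₀ δ Ω μ π hn hT hδ hδ₁
      hf.differentiable hf.lower_bound hf.lipschitz hπ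
  · obtain ⟨K, hK, hgeneral⟩ := (mainTheorem1_general.{0, 0, 0, _} L hL).2 Φ
    refine ⟨K, hK, fun n ε δ hn hε hε₁ hδ hδ₁ => ?_⟩
    obtain ⟨T₀, hT₀, hcost, hbound⟩ := hgeneral n ε δ hn hε hε₁ hδ hδ₁
    refine ⟨T₀, hT₀, hcost, fun T hT d f lb fbar x₀ Ω _ μ _ π hf _ hF hπ => ?_⟩
    rw [RandomReshuffling.constF_eq_three_mul_gap f (NNReal.coe_ne_zero.2 hL.ne') hn] at hF
    simp only [RandomReshuffling.avgSqGrad_eq_avgSqNormGradient]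
    exact hbound T hT _ f lb x₀ Ω μ π hf.differentiable hf.lower_bound hf.lipschitz hF hπ
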